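/- Let $\mathbb D=\{z\in\mathbb C:|z|<1\}$ and equip the Riemann sphere $\hat{\mathbb C}=\mathbb C\cup\{\infty\}$ with the spherical metric $|dz|/(1+|z|^2)$. A domain $\Omega\subseteq\hat{\mathbb C}$ is called spherically convex if for any two non-antipodal points $a,b\in\Omega$ the smaller arc of the great circle through $a$ and $b$ joining $a$ to $b$ lies in $\Omega$. A meromorphic injective map $f:\mathbb D\to\hat{\mathbb C}$ is called spherically convex if $f(\mathbb D)$ is a spherically convex domain. Write $f^\sharp=|f'|/(1+|f|^2)$ for the spherical derivative of $f$ (extended continuously to the pole of $f$, if there is one), and for $0<r<1$ let $$A_f(r)=\iint_{r\mathbb D} f^\sharp(z)^2\,dA(z),\qquad A(r)=\iint_{r\mathbb D}\frac{dA(z)}{(1+|z|^2)^2}$$ be the spherical areas of $f(r\mathbb D)$ and of $r\mathbb D$, where $dA$ is Lebesgue measure. Theorem. Let $f:\mathbb D\to\hat{\mathbb C}$ be spherically convex. Then $$A_f(r)\le A(r)=\frac{\pi r^2}{1+r^2}\qquad\text{for every }0<r<1 .$$ Moreover, equality $A_f(r)=A(r)$ holds for some $0<r<1$ if and only if $f$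 is a spherical isometry, that is, the restriction to $\mathbb D$ of a rotation $z\mapsto e^{i\theta}\frac{z-a}{1+\overline a z}$ ($a\in\mathbb C$, $\theta\in\mathbb R$) or $z\mapsto e^{i\theta}/z$ ($\theta\in\mathbb R$) of $\hat{\mathbb C}$; in that case equality holds for every $0<r<1$. -/

import Mathlib

open scoped OnePoint

namespace SphericalGeometry

noncomputable section

/-- The standard chart of the Riemann sphere `OnePoint ℂ` on the complement of `∞`,
extended by the value `0` at `∞`. -/
def chart (p : OnePoint ℂ) : ℂ := p.elim (0 : ℂ) (fun z : ℂ => z)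

/-- The chart `z ↦ 1 / z` of the Riemann sphere on the complement of `0`, with `1 / ∞ = 0`
(its value at `0` is never used). -/
def chartInv (p : OnePoint ℂ) : ℂ := p.elim (0 : ℂ) (fun z : ℂ => z⁻¹)

/-- `f` is a meromorphic map from the open set `U` to the Riemann sphere, i.e. a holomorphic map
into the Riemann surface `OnePoint ℂ`: it is continuous, and it is complex differentiable in
each of the two standard charts. -/
def IsMeromorphicMapOn (f : ℂ → OnePoint ℂ) (U : Set ℂ) : Prop :=
  ContinuousOn f U ∧ ∀ z ∈ U,
    (f z ≠ ∞ → DifferentiableAt ℂ (fun w => chart (f w)) z) ∧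
    (f z ≠ ((0 : ℂ) : OnePoint ℂ) → DifferentiableAt ℂ (fun w => chartInv (f w)) z)

/-- The spherical derivative `|f'| / (1 + |f|²)`; at a pole it is computed from `1 / f`, which is
its continuous extension. -/
def sphericalDeriv (f : ℂ → OnePoint ℂ) (z : ℂ) : ℝ :=
  open Classical in
  if f z = ∞ then
    ‖deriv (fun w => chartInv (f w)) z‖ / (1 + ‖chartInv (f z)‖ ^ 2)
  else
    ‖deriv (fun w => chart (f w)) z‖ / (1 + ‖chart (f z)‖ ^ 2)

/-- Inverse stereographic projection from the Riemann sphere onto the unit sphere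
`|w|² + t² = 1` of `ℂ × ℝ = ℝ³`. -/
def toSphere (p : OnePoint ℂ) : ℂ × ℝ :=
  p.elim ((0, 1) : ℂ × ℝ)
    (fun z : ℂ => (((2 / (1 + ‖z‖ ^ 2) : ℝ) : ℂ) * z, (‖z‖ ^ 2 - 1) / (‖z‖ ^ 2 + 1)))

/-- Antipodal points of the Riemann sphere. -/
def IsAntipodal (a b : OnePoint ℂ) : Prop := toSphere b = -toSphere a

/-- For non-antipodal `a`, `b`, the spherical geodesic joining `a` and `b`, i.e. the smaller arc
of the great circle through `a` and `b`: the points of the sphere that are combinations of `a`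
and `b` in `ℝ³` with nonnegative coefficients. -/
def geodesic (a b : OnePoint ℂ) : Set (OnePoint ℂ) :=
  {p | ∃ s t : ℝ, 0 ≤ s ∧ 0 ≤ t ∧ toSphere p = s • toSphere a + t • toSphere b}

/-- Spherically convex domains of the Riemann sphere. -/
def IsSphericallyConvexDomain (Ω : Set (OnePoint ℂ)) : Prop :=
  IsOpen Ω ∧ IsConnected Ω ∧
    ∀ a ∈ Ω, ∀ b ∈ Ω, ¬ IsAntipodal a b → geodesic a b ⊆ Ω

/-- `f` restricts to a meromorphic univalent map of the unit disk onto a spherically convex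
domain. The values of `f` outside the unit disk are irrelevant. -/
def IsSphericallyConvexMap (f : ℂ → OnePoint ℂ) : Prop :=
  IsMeromorphicMapOn f (Metric.ball 0 1) ∧ Set.InjOn f (Metric.ball 0 1) ∧
    IsSphericallyConvexDomain (f '' Metric.ball 0 1)

/-- The spherical area of the image `f(rD)`, i.e. the integral of the squared spherical
derivative over the disk `rD` with respect to Lebesgue measure. -/
def imageArea (f : ℂ → OnePoint ℂ) (r : ℝ) : ENNReal :=
  ∫⁻ z in Metric.ball (0 : ℂ) r, ENNReal.ofReal (sphericalDeriv f z ^ 2)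

/-- The spherical area of the disk `rD`. -/
def diskArea (r : ℝ) : ENNReal :=
  ∫⁻ z in Metric.ball (0 : ℂ) r, ENNReal.ofReal (1 / (1 + ‖z‖ ^ 2) ^ 2)

/-- The quotient of two complex numbers that do not both vanish, as a point of the Riemann
sphere. -/
def sphereDiv (p q : ℂ) : OnePoint ℂ :=
  open Classical in if q = 0 then ∞ else ((p / q : ℂ) : OnePoint ℂ)

/-- The rotation `z ↦ exp(iθ) (z - a) / (1 + z conj(a))` of the Riemann sphere. -/
def sphereRotation (θ : ℝ) (a : ℂ) (p : OnePoint ℂ) : OnePoint ℂ :=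
  p.elim (sphereDiv (Complex.exp (θ * Complex.I)) (starRingEnd ℂ a))
    (fun z : ℂ =>
      sphereDiv (Complex.exp (θ * Complex.I) * (z - a)) (1 + z * starRingEnd ℂ a))

/-- The rotation `z ↦ exp(iθ) / z` of the Riemann sphere. -/
def sphereRotationInv (θ : ℝ) (p : OnePoint ℂ) : OnePoint ℂ :=
  p.elim ((0 : ℂ) : OnePoint ℂ)
    (fun z : ℂ => sphereDiv (Complex.exp (θ * Complex.I)) z)

/-- The group of rotations of the Riemann sphere, i.e. of its meromorphic isometries. -/
def sphereRotations : Set (OnePoint ℂ → OnePoint ℂ) :=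
  {T | ∃ (θ : ℝ) (a : ℂ), T = sphereRotation θ a} ∪ {T | ∃ θ : ℝ, T = sphereRotationInv θ}

/-- On the unit disk, `f` is (the restriction of) a rotation of the Riemann sphere. -/
def IsSphericalIsometry (f : ℂ → OnePoint ℂ) : Prop :=
  ∃ T ∈ sphereRotations, ∀ z ∈ Metric.ball (0 : ℂ) 1, f z = T (z : OnePoint ℂ)

end

end SphericalGeometry

namespace SphericalGeometry

open MeasureTheory Set Metric Filter Topology Complex
open scoped Real ComplexConjugate Interval

/-! For the metric |dz|/(1+|z|²) the sphere has area π. Write A(r) for the area of f(rD) and L(r)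
for the length of its boundary curve.

Convexity enters through antipodal points. A spherically convex domain with an antipodal pair is the
whole sphere (`eq_univ_of_isAntipodal`), and the injective image of D is not the whole sphere
(`image_ball_ne_univ`). So f(D) contains no antipodal pair. A rotation of the target then makes f
holomorphic and finite (`exists_holomorphic_model`). Moreover f(D) is disjoint from its antipodal
image, which has the same area, so A(r) ≤ π/2 (`lintegral_sph_sq_le`).

The isoperimetric inequality 4A(π - A) ≤ L² (`isoperimetric`) is obtained by integrating a kernel of
modulus f♯(ζ)f♯(η) over two concentric circles: Green's formula and the argument principle evaluate
the integral exactly. Cauchy-Schwarz gives L² ≤ 2πrA'(r). Together they say that A/((π - A)r²) is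
nondecreasing (`monotoneOn_area_ratio`). Since A ≤ π/2, this ratio is at most 1/t² at radius t, and
t → 1 bounds it by 1, which is the claimed estimate.

If equality holds at r, the ratio is 1 on [r, 1), so both inequalities are equalities there and
f♯(z) = 1/(1+|z|²) on an annulus (`sph_eq_of_discArea_eq`). With g² = f', this reads |f/g|² + |1/g|²
= 1 + |z|², which forces f/g and 1/g to be affine with a unitary coefficient matrix
(`exists_eq_moebius_of_sph_eq`). Thus f is a rotation. -/

/-! ### Polar coordinates and Green's formula on a disk. -/

theorem polarCoord_symm_eq_circleMap (p : ℝ × ℝ) :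
    Complex.polarCoord.symm p = circleMap 0 p.1 p.2 := by
  rw [Complex.polarCoord_symm_apply, circleMap, zero_add, Complex.exp_mul_I]
  push_cast
  rfl

theorem continuous_circleMap_uncurry : Continuous fun p : ℝ × ℝ => circleMap 0 p.1 p.2 := by
  unfold circleMap
  fun_prop

theorem circleMap_zero_mem_closedBall {t r : ℝ} (ht : 0 ≤ t) (htr : t ≤ r) (θ : ℝ) :
    circleMap 0 t θ ∈ closedBall (0 : ℂ) r := by
  simp [abs_of_nonneg ht, htr]

theorem circleMap_zero_mem_ball {t r : ℝ} (ht : 0 ≤ t) (htr : t < r) (θ : ℝ) :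
    circleMap 0 t θ ∈ ball (0 : ℂ) r := by
  simp [abs_of_nonneg ht, htr]

/-- Polar coordinates use angles in (-π, π), circle integrals use [0, 2π]; periodicity of
`circleMap` reconciles them. -/
theorem setIntegral_ball_eq_polar {g : ℂ → ℝ} {r : ℝ} (hr : 0 ≤ r)
    (hg : ContinuousOn g (closedBall 0 r)) :
    ∫ z in ball (0 : ℂ) r, g z
      = ∫ t in (0 : ℝ)..r, t * ∫ θ in (0 : ℝ)..2 * π, g (circleMap 0 t θ) := by
  have hper : ∀ t : ℝ, ∫ θ in (0 : ℝ)..2 * π, g (circleMap 0 t θ)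
      = ∫ θ in (-π)..π, g (circleMap 0 t θ) := by
    intro t
    have h := (periodic_circleMap 0 t).comp g
    have := h.intervalIntegral_add_eq 0 (-π)
    simpa [show -π + 2 * π = π by ring] using this
  simp_rw [hper]
  rw [← integral_indicator measurableSet_ball, ← Complex.integral_comp_polarCoord_symm]
  have h1 : ∀ p : ℝ × ℝ, p ∈ polarCoord.target →
      p.1 • (ball (0 : ℂ) r).indicator g (Complex.polarCoord.symm p)
        = (Ioo 0 r ×ˢ Ioo (-π) π).indicator (fun p : ℝ × ℝ => p.1 * g (circleMap 0 p.1 p.2)) p := by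
    rintro ⟨t, θ⟩ ⟨ht, hθ⟩
    simp only [mem_Ioi] at ht
    rw [polarCoord_symm_eq_circleMap]
    by_cases htr : t < r
    · rw [indicator_of_mem (circleMap_zero_mem_ball ht.le htr θ), indicator_of_mem
        (show (t, θ) ∈ Ioo 0 r ×ˢ Ioo (-π) π from ⟨⟨ht, htr⟩, hθ⟩)]
      rfl
    · rw [indicator_of_notMem, indicator_of_notMem]
      · simp
      · rintro ⟨⟨_, h⟩, _⟩
        exact htr h
      · simpa [abs_of_pos ht] using htr
  rw [setIntegral_congr_fun polarCoord.open_target.measurableSet h1,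
    setIntegral_indicator (measurableSet_Ioo.prod measurableSet_Ioo)]
  have h2 : polarCoord.target ∩ Ioo 0 r ×ˢ Ioo (-π) π = Ioo 0 r ×ˢ Ioo (-π) π := by
    apply inter_eq_self_of_subset_right
    rintro ⟨t, θ⟩ ⟨ht, hθ⟩
    exact ⟨ht.1, hθ⟩
  rw [h2]
  have hc : ContinuousOn (fun p : ℝ × ℝ => p.1 * g (circleMap 0 p.1 p.2))
      (Icc 0 r ×ˢ Icc (-π) π) := by
    refine continuousOn_fst.mul (hg.comp continuous_circleMap_uncurry.continuousOn ?_)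
    rintro ⟨t, θ⟩ ⟨ht, _⟩
    exact circleMap_zero_mem_closedBall ht.1 ht.2 θ
  rw [Measure.volume_eq_prod, setIntegral_prod, intervalIntegral.integral_of_le hr,
    integral_Ioc_eq_integral_Ioo]
  · refine setIntegral_congr_fun measurableSet_Ioo fun t _ => ?_
    simp only
    rw [integral_const_mul, intervalIntegral.integral_of_le (by linarith [Real.pi_pos]),
      integral_Ioc_eq_integral_Ioo]
  · exact (hc.integrableOn_compact (isCompact_Icc.prod isCompact_Icc)).mono_set
      (prod_mono Ioo_subset_Icc_self Ioo_subset_Icc_self)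

theorem setLIntegral_ball_eq_polar {g : ℂ → ℝ} {r : ℝ} (hr : 0 ≤ r)
    (hg : ContinuousOn g (closedBall 0 r)) (hg0 : ∀ z, 0 ≤ g z) :
    ∫⁻ z in ball (0 : ℂ) r, ENNReal.ofReal (g z)
      = ENNReal.ofReal (∫ t in (0 : ℝ)..r, t * ∫ θ in (0 : ℝ)..2 * π, g (circleMap 0 t θ)) := by
  rw [← setIntegral_ball_eq_polar hr hg, ofReal_integral_eq_lintegral_ofReal]
  · exact (hg.integrableOn_compact (isCompact_closedBall _ _)).mono_set ball_subset_closedBall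
  · exact Eventually.of_forall hg0

theorem hasFDerivAt_exp_snd_mul_I (p : ℝ × ℝ) :
    HasFDerivAt (fun p : ℝ × ℝ => exp (p.2 * I))
      ((ContinuousLinearMap.snd ℝ ℝ ℝ).smulRight (exp (p.2 * I) * I)) p := by
  have h : HasDerivAt (fun θ : ℝ => exp (θ * I)) (exp (p.2 * I) * I) p.2 := by
    simpa using ((hasDerivAt_id (p.2 : ℂ)).mul_const I).cexp.comp_ofReal
  refine (h.hasFDerivAt.comp p (hasFDerivAt_snd (𝕜 := ℝ))).congr_fderiv ?_
  ext <;> simp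

theorem hasFDerivAt_circleMap_uncurry (p : ℝ × ℝ) :
    HasFDerivAt (fun p : ℝ × ℝ => circleMap 0 p.1 p.2)
      ((ContinuousLinearMap.fst ℝ ℝ ℝ).smulRight (exp (p.2 * I))
        + (ContinuousLinearMap.snd ℝ ℝ ℝ).smulRight (circleMap 0 p.1 p.2 * I)) p := by
  have h1 : HasFDerivAt (fun p : ℝ × ℝ => (p.1 : ℂ))
      ((ContinuousLinearMap.fst ℝ ℝ ℝ).smulRight (1 : ℂ)) p := by
    have := (ofRealCLM.hasFDerivAt (x := p.1)).comp p (hasFDerivAt_fst (𝕜 := ℝ))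
    refine this.congr_fderiv ?_
    ext <;> simp
  have := h1.mul (hasFDerivAt_exp_snd_mul_I p)
  simp only [circleMap, zero_add]
  refine this.congr_fderiv ?_
  ext <;> simp [mul_assoc]

/-- Green's formula on a disk, in polar coordinates. -/
theorem circleIntegral_eq_polar_of_hasFDerivAt {P α β : ℂ → ℂ} {r : ℝ} (hr : 0 ≤ r)
    (hP : ContinuousOn P (closedBall 0 r)) (hβ : ContinuousOn β (closedBall 0 r))
    (hd : ∀ z ∈ ball (0 : ℂ) r, HasFDerivAt P
      (α z • (ContinuousLinearMap.id ℝ ℂ) + β z • (conjCLE : ℂ →L[ℝ] ℂ)) z) :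
    ∮ z in C(0, r), P z
      = 2 * I * ∫ t in (0 : ℝ)..r, t * ∫ θ in (0 : ℝ)..2 * π, β (circleMap 0 t θ) := by
  have hmaps : MapsTo (fun p : ℝ × ℝ => circleMap 0 p.1 p.2) ([[0, r]] ×ˢ [[0, 2 * π]])
      (closedBall 0 r) := by
    rintro ⟨t, θ⟩ ⟨ht, _⟩
    rw [uIcc_of_le hr] at ht
    exact circleMap_zero_mem_closedBall ht.1 ht.2 θ
  have hc : ContinuousOn (fun p : ℝ × ℝ => circleMap 0 p.1 p.2) ([[0, r]] ×ˢ [[0, 2 * π]]) :=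
    continuous_circleMap_uncurry.continuousOn
  set Z : ℝ × ℝ → ℂ := fun p => circleMap 0 p.1 p.2 with hZ
  set Z' : ℝ × ℝ → ℝ × ℝ →L[ℝ] ℂ := fun p =>
    (ContinuousLinearMap.fst ℝ ℝ ℝ).smulRight (exp (p.2 * I))
        + (ContinuousLinearMap.snd ℝ ℝ ℝ).smulRight (Z p * I) with hZ'
  set E' : ℝ × ℝ → ℝ × ℝ →L[ℝ] ℂ := fun p =>
    (ContinuousLinearMap.snd ℝ ℝ ℝ).smulRight (exp (p.2 * I) * I) with hE'
  set P' : ℝ × ℝ → ℝ × ℝ →L[ℝ] ℂ := fun p =>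
    (α (Z p) • (ContinuousLinearMap.id ℝ ℂ) + β (Z p) • (conjCLE : ℂ →L[ℝ] ℂ)).comp (Z' p) with hP'
  -- With dz = e^{iθ} dt + iz dθ, this is ∂_t(P·iz) - ∂_θ(P·e^{iθ}). The terms in P and in α cancel,
  -- and the two terms in β add up to 2itβ.
  have hsum : ∀ p : ℝ × ℝ,
      (P (Z p) • (I • Z' p) + (P' p).smulRight (Z p * I)) (1, 0)
        + (-(P (Z p) • (E' p) + (P' p).smulRight (exp (p.2 * I)))) (0, 1)
      = 2 * I * (p.1 * β (Z p)) := by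
    intro p
    have e1 : conj (exp (p.2 * I)) * exp (p.2 * I) = 1 := by
      rw [← exp_conj, ← Complex.exp_add]; simp
    simp [hP', hZ', hE', hZ, circleMap]
    linear_combination (2 * I * p.1 * β (↑p.1 * exp (↑p.2 * I))) * e1
  have hin : ∀ p ∈ Ioo (min 0 r) (max 0 r) ×ˢ Ioo (min 0 (2 * π)) (max 0 (2 * π)),
      HasFDerivAt (fun p => P (Z p)) (P' p) p := by
    rintro p ⟨ht, _⟩
    rw [min_eq_left hr, max_eq_right hr] at ht
    have hz : Z p ∈ ball (0 : ℂ) r := circleMap_zero_mem_ball ht.1.le ht.2 _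
    exact (hd _ hz).comp p (hasFDerivAt_circleMap_uncurry p)
  have key := integral2_divergence_prod_of_hasFDerivAt
    (fun p : ℝ × ℝ => P (Z p) * (Z p * I)) (fun p : ℝ × ℝ => -(P (Z p) * exp (p.2 * I)))
    (fun p => P (Z p) • (I • Z' p) + (P' p).smulRight (Z p * I))
    (fun p => -(P (Z p) • (E' p) + (P' p).smulRight (exp (p.2 * I)))) 0 0 r (2 * π)
    ((hP.comp hc hmaps).mul (hc.mul continuousOn_const))
    ((hP.comp hc hmaps).mul (Continuous.continuousOn (by fun_prop))).neg
    (fun p hp => by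
      refine ((hin p hp).mul ((hasFDerivAt_circleMap_uncurry p).mul_const I)).congr_fderiv ?_
      ext <;> simp [hZ', hZ, mul_comm])
    (fun p hp => by
      refine ((hin p hp).mul (hasFDerivAt_exp_snd_mul_I p)).neg.congr_fderiv ?_
      ext <;> simp [hE', mul_comm])
    (by
      simp_rw [hsum]
      refine ContinuousOn.integrableOn_compact (isCompact_uIcc.prod isCompact_uIcc) ?_
      exact continuousOn_const.mul ((Continuous.continuousOn (by fun_prop)).mul
        (hβ.comp hc hmaps)))
  simp_rw [hsum] at key
  simp only [intervalIntegral.integral_const_mul] at key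
  -- Of the four sides of the rectangle only t = r survives: the factor z vanishes at t = 0, and the
  -- sides θ = 0 and θ = 2π cancel.
  rw [key]
  simp only [circleIntegral, deriv_circleMap, hZ]
  have h2π : exp (I * (π * 2)) = 1 := by
    rw [← exp_two_pi_mul_I]
    ring_nf
  simp [circleMap, mul_comm, h2π]

/-! ### Spherical area as a contour integral, and the argument principle. -/

noncomputable section


/-- The spherical derivative of a finite-valued function. -/
def sph (f : ℂ → ℂ) (z : ℂ) : ℝ := ‖deriv f z‖ / (1 + ‖f z‖ ^ 2)

/-- The function `conj f / (1 + |f|²)`, a potential of the spherical area. -/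
def areaPotential (f : ℂ → ℂ) (z : ℂ) : ℂ := conj (f z) / (1 + f z * conj (f z))

/-- The mean square of the spherical derivative over a circle, times `2 * π`. -/
def circleEnergy (f : ℂ → ℂ) (t : ℝ) : ℝ := ∫ θ in (0 : ℝ)..2 * π, sph f (circleMap 0 t θ) ^ 2

/-- The spherical area of the image of the disk of radius `r`. -/
def discArea (f : ℂ → ℂ) (r : ℝ) : ℝ := ∫ t in (0 : ℝ)..r, t * circleEnergy f t

/-- The spherical length of the image of the circle of radius `r`. -/
def circleLength (f : ℂ → ℂ) (r : ℝ) : ℝ := ∫ θ in (0 : ℝ)..2 * π, r * sph f (circleMap 0 r θ)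

theorem one_add_mul_conj (w : ℂ) : 1 + w * conj w = ((1 + ‖w‖ ^ 2 : ℝ) : ℂ) := by
  rw [mul_conj, normSq_eq_norm_sq]
  push_cast
  rfl

theorem one_add_mul_conj_ne_zero (w : ℂ) : 1 + w * conj w ≠ 0 := by
  rw [one_add_mul_conj]
  exact_mod_cast (by positivity : (1 + ‖w‖ ^ 2 : ℝ) ≠ 0)

theorem sph_nonneg (f : ℂ → ℂ) (z : ℂ) : 0 ≤ sph f z := by
  unfold sph
  positivity

theorem ofReal_sph_sq (f : ℂ → ℂ) (z : ℂ) :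
    ((sph f z ^ 2 : ℝ) : ℂ) = deriv f z * conj (deriv f z) / (1 + f z * conj (f z)) ^ 2 := by
  rw [one_add_mul_conj, mul_conj, normSq_eq_norm_sq, sph, div_pow]
  push_cast
  rfl

variable {f : ℂ → ℂ}

theorem continuousOn_deriv_ball (hf : DifferentiableOn ℂ f (ball 0 1)) :
    ContinuousOn (deriv f) (ball 0 1) :=
  (hf.deriv isOpen_ball).continuousOn

theorem continuousOn_sph (hf : DifferentiableOn ℂ f (ball 0 1)) :
    ContinuousOn (sph f) (ball 0 1) := by
  have h1 := continuousOn_deriv_ball hf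
  have h2 := hf.continuousOn
  refine h1.norm.div (by fun_prop) fun z _ => by positivity

theorem continuousOn_areaPotential (hf : DifferentiableOn ℂ f (ball 0 1)) :
    ContinuousOn (areaPotential f) (ball 0 1) := by
  have h2 := hf.continuousOn
  have h3 : ContinuousOn (fun z => conj (f z)) (ball 0 1) := continuous_conj.comp_continuousOn h2
  exact h3.div (continuousOn_const.add (h2.mul h3)) fun z _ => one_add_mul_conj_ne_zero _

/-- Only the coefficient of `conj` matters: the ∂/∂z̄ derivative of the potential times f' is (f♯)²,
so Green's formula turns the area into a contour integral. The holomorphic factor f' contributes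
nothing to it. -/
theorem hasFDerivAt_areaPotential_mul_deriv (hf : DifferentiableOn ℂ f (ball 0 1)) {z : ℂ}
    (hz : z ∈ ball (0 : ℂ) 1) :
    HasFDerivAt (fun z => areaPotential f z * deriv f z)
      ((areaPotential f z * deriv (deriv f) z
          - conj (f z) ^ 2 * deriv f z ^ 2 / (1 + f z * conj (f z)) ^ 2) •
            (ContinuousLinearMap.id ℝ ℂ)
        + ((sph f z ^ 2 : ℝ) : ℂ) • (conjCLE : ℂ →L[ℝ] ℂ)) z := by
  have hnhds := isOpen_ball.mem_nhds hz
  have h1 : HasFDerivAt f ((deriv f z) • (ContinuousLinearMap.id ℝ ℂ)) z := by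
    refine ((hf.differentiableAt hnhds).hasDerivAt.hasFDerivAt.restrictScalars ℝ).congr_fderiv ?_
    ext
    simp [mul_comm]
  have h2 : HasFDerivAt (deriv f) ((deriv (deriv f) z) • (ContinuousLinearMap.id ℝ ℂ)) z := by
    refine ((((hf.deriv isOpen_ball).differentiableAt hnhds).hasDerivAt.hasFDerivAt).restrictScalars
      ℝ).congr_fderiv ?_
    ext
    simp [mul_comm]
  have h3 : HasFDerivAt (fun z => conj (f z))
      ((conjCLE : ℂ →L[ℝ] ℂ).comp ((deriv f z) • (ContinuousLinearMap.id ℝ ℂ))) z :=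
    (conjCLE : ℂ →L[ℝ] ℂ).hasFDerivAt.comp z h1
  have h4 := (h1.mul h3).const_add 1
  have hne := one_add_mul_conj_ne_zero (f z)
  have h5 := ((hasDerivAt_inv hne).hasFDerivAt.restrictScalars ℝ).comp z h4
  have h6 := (h3.mul h5).mul h2
  refine (h6.congr_of_eventuallyEq (Eventually.of_forall fun w => ?_)).congr_fderiv ?_
  · simp [areaPotential, div_eq_mul_inv]
  · rw [ofReal_sph_sq]
    ext
    simp [areaPotential]
    field_simp
    ring

theorem circleIntegral_areaPotential (hf : DifferentiableOn ℂ f (ball 0 1)) {r : ℝ} (hr : 0 ≤ r)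
    (hr1 : r < 1) :
    ∮ z in C(0, r), areaPotential f z * deriv f z = 2 * I * discArea f r := by
  have hsub : closedBall (0 : ℂ) r ⊆ ball 0 1 := closedBall_subset_ball hr1
  rw [circleIntegral_eq_polar_of_hasFDerivAt (P := fun z => areaPotential f z * deriv f z) hr
    (((continuousOn_areaPotential hf).mul (continuousOn_deriv_ball hf)).mono hsub)
    (continuous_ofReal.comp_continuousOn (((continuousOn_sph hf).pow 2).mono hsub))
    (fun z hz => hasFDerivAt_areaPotential_mul_deriv hf (ball_subset_ball hr1.le hz))]
  simp only [discArea, circleEnergy, ← intervalIntegral.integral_ofReal]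
  congr 1
  refine intervalIntegral.integral_congr fun t _ => ?_
  push_cast
  rw [← intervalIntegral.integral_ofReal]
  simp

/-- The argument principle for an injective function. -/
theorem circleIntegral_deriv_div_sub (hf : DifferentiableOn ℂ f (ball 0 1))
    (hinj : InjOn f (ball 0 1)) {r : ℝ} (hr1 : r < 1) {η : ℂ}
    (hη : η ∈ ball (0 : ℂ) r) (hη' : deriv f η ≠ 0) :
    ∮ ζ in C(0, r), deriv f ζ / (f ζ - f η) = 2 * π * I := by
  have hr : 0 < r := pos_of_mem_ball hη
  have hη1 : η ∈ ball (0 : ℂ) 1 := ball_subset_ball hr1.le hη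
  have hsub : closedBall (0 : ℂ) r ⊆ ball 0 1 := closedBall_subset_ball hr1
  -- f - f(η) = (z - η)·d with d holomorphic and, by injectivity and f'(η) ≠ 0, zero-free. The
  -- logarithmic derivative splits as 1/(ζ - η) + d'/d, and the second term is holomorphic.
  set d := dslope f η with hd
  have hdd : DifferentiableOn ℂ d (ball 0 1) :=
    (Complex.differentiableOn_dslope (isOpen_ball.mem_nhds hη1)).2 hf
  have hd0 : ∀ z ∈ ball (0 : ℂ) 1, d z ≠ 0 := by
    intro z hz
    rcases eq_or_ne z η with rfl | hzη
    · rwa [hd, dslope_same]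
    · rw [hd, dslope_of_ne _ hzη, slope_def_field]
      exact div_ne_zero (sub_ne_zero.2 fun h => hzη (hinj hz hη1 h)) (sub_ne_zero.2 hzη)
  have hfd : ∀ z, f z - f η = (z - η) * d z := fun z => by
    rw [hd, ← smul_eq_mul, sub_smul_dslope]
  have hq : DifferentiableOn ℂ (fun z => deriv d z / d z) (ball 0 1) :=
    (hdd.deriv isOpen_ball).div hdd hd0
  have hcongr : EqOn (fun ζ => deriv f ζ / (f ζ - f η))
      (fun ζ => (ζ - η)⁻¹ + deriv d ζ / d ζ) (sphere 0 r) := by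
    intro ζ hζ
    have hζ1 : ζ ∈ ball (0 : ℂ) 1 := hsub (sphere_subset_closedBall hζ)
    have hne : ζ - η ≠ 0 := sub_ne_zero.2 (by
      rintro rfl
      simp only [mem_sphere, mem_ball] at hζ hη
      linarith)
    have hder : deriv f ζ = d ζ + (ζ - η) * deriv d ζ := by
      have h1 : HasDerivAt (fun z => f η + (z - η) * d z)
          (1 * d ζ + (ζ - η) * deriv d ζ) ζ :=
        (((hasDerivAt_id ζ).sub_const η).mul
          (hdd.differentiableAt (isOpen_ball.mem_nhds hζ1)).hasDerivAt).const_add _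
      have h2 : f = fun z => f η + (z - η) * d z := by
        funext z
        rw [← hfd]
        ring
      rw [one_mul] at h1
      rw [← h1.deriv, ← h2]
    simp only
    rw [hder, hfd]
    have := hd0 ζ hζ1
    field_simp
  rw [circleIntegral.integral_congr hr.le hcongr, circleIntegral.integral_add,
    circleIntegral.integral_sub_inv_of_mem_ball hη,
    Complex.circleIntegral_eq_zero_of_differentiable_on_off_countable hr.le countable_empty
      (hq.continuousOn.mono hsub), add_zero]
  · rintro z ⟨hz, _⟩
    exact hq.differentiableAt (isOpen_ball.mem_nhds (ball_subset_ball hr1.le hz))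
  · rw [circleIntegrable_sub_inv_iff]
    right
    intro h
    simp only [mem_sphere, mem_ball, abs_of_pos hr] at h hη
    linarith
  · exact (hq.continuousOn.mono (sphere_subset_closedBall.trans hsub)).circleIntegrable hr.le

theorem circleIntegral_deriv_div_sub_of_notMem (hf : DifferentiableOn ℂ f (ball 0 1))
    (hinj : InjOn f (ball 0 1)) {ρ : ℝ} (hρ : 0 ≤ ρ) (hρ1 : ρ < 1) {ζ : ℂ}
    (hζ : ζ ∈ ball (0 : ℂ) 1) (hζ' : ζ ∉ closedBall (0 : ℂ) ρ) :
    ∮ η in C(0, ρ), deriv f η / (f ζ - f η) = 0 := by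
  have hsub : closedBall (0 : ℂ) ρ ⊆ ball 0 1 := closedBall_subset_ball hρ1
  have hd : ∀ z ∈ closedBall (0 : ℂ) ρ,
      DifferentiableAt ℂ (fun η => deriv f η / (f ζ - f η)) z := by
    intro z hz
    have hn := isOpen_ball.mem_nhds (hsub hz)
    refine (((hf.deriv isOpen_ball).differentiableAt hn)).div
      ((hf.differentiableAt hn).const_sub _) (sub_ne_zero.2 fun h => hζ' ?_)
    rwa [hinj hζ (hsub hz) h]
  exact Complex.circleIntegral_eq_zero_of_differentiable_on_off_countable hρ countable_empty
    (fun z hz => (hd z hz).continuousAt.continuousWithinAt)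
    fun z hz => hd z (ball_subset_closedBall hz.1)

theorem circleIntegral_swap {F : ℂ → ℂ → ℂ} {r ρ : ℝ} (hr : 0 ≤ r) (hρ : 0 ≤ ρ)
    (hF : ContinuousOn (fun p : ℂ × ℂ => F p.1 p.2) (sphere 0 r ×ˢ sphere 0 ρ)) :
    ∮ ζ in C(0, r), ∮ η in C(0, ρ), F ζ η = ∮ η in C(0, ρ), ∮ ζ in C(0, r), F ζ η := by
  simp only [circleIntegral, smul_eq_mul, ← intervalIntegral.integral_const_mul]
  rw [intervalIntegral_intervalIntegral_swap]
  · refine intervalIntegral.integral_congr fun φ _ => intervalIntegral.integral_congr fun θ _ => ?_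
    ring
  · have hc : Continuous fun p : ℝ × ℝ => F (circleMap 0 r p.1) (circleMap 0 ρ p.2) := by
      refine hF.comp_continuous (f := fun p : ℝ × ℝ => (circleMap 0 r p.1, circleMap 0 ρ p.2))
        (by fun_prop) fun p => ⟨circleMap_mem_sphere _ hr _, circleMap_mem_sphere _ hρ _⟩
    simp only [deriv_circleMap]
    have : Continuous (Function.uncurry fun θ φ : ℝ => circleMap 0 r θ * I *
        (circleMap 0 ρ φ * I * F (circleMap 0 r θ) (circleMap 0 ρ φ))) := by
      have h1 := continuous_circleMap (0 : ℂ) r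
      have h2 := continuous_circleMap (0 : ℂ) ρ
      exact ((h1.comp continuous_fst).mul continuous_const).mul
        (((h2.comp continuous_snd).mul continuous_const).mul hc)
    exact (this.continuousOn.integrableOn_compact (isCompact_uIcc.prod isCompact_uIcc)).mono_set
      (prod_mono uIoc_subset_uIcc uIoc_subset_uIcc)

end

/-! ### The spherical isoperimetric inequality. -/

noncomputable section


/-- The kernel whose double contour integral expresses the isoperimetric deficit. -/
def isoKernel (f : ℂ → ℂ) (ζ η : ℂ) : ℂ :=
  ((areaPotential f ζ - areaPotential f η) / (f ζ - f η) + areaPotential f ζ * areaPotential f η)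
    * (deriv f ζ * deriv f η)

variable {f : ℂ → ℂ}

/-- The identity behind `norm_isoKernel`, with the conjugates of w and z replaced by independent
variables a and b. -/
theorem isoKernel_algebra {w z a b c d X Y : ℂ} (hne : w - z ≠ 0) (h1 : X ≠ 0) (h2 : Y ≠ 0)
    (hX : X = 1 + w * a) (hY : Y = 1 + z * b) :
    ((a / X - b / Y) / (w - z) + a / X * (b / Y)) * (c * d)
      = (a - b) / (w - z) * (c / X) * (d / Y) := by
  field_simp
  rw [hX, hY]
  ring

/-- The kernel factors as the unimodular number conj(f ζ - f η)/(f ζ - f η) times f'/(1+|f|²) at ζ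
and at η. -/
theorem norm_isoKernel {ζ η : ℂ} (h : f ζ ≠ f η) : ‖isoKernel f ζ η‖ = sph f ζ * sph f η := by
  have hne : f ζ - f η ≠ 0 := sub_ne_zero.2 h
  have h1 := one_add_mul_conj_ne_zero (f ζ)
  have h2 := one_add_mul_conj_ne_zero (f η)
  have key : isoKernel f ζ η = conj (f ζ - f η) / (f ζ - f η) *
      (deriv f ζ / (1 + f ζ * conj (f ζ))) * (deriv f η / (1 + f η * conj (f η))) := by
    rw [isoKernel, areaPotential, areaPotential, map_sub]
    exact isoKernel_algebra hne h1 h2 rfl rfl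
  rw [key, norm_mul, norm_mul, norm_div, norm_div, norm_div, one_add_mul_conj, one_add_mul_conj,
    norm_real, norm_real, RCLike.norm_conj, div_self (norm_ne_zero_iff.2 hne), one_mul,
    Real.norm_of_nonneg (by positivity), Real.norm_of_nonneg (by positivity)]
  rfl

/-- Different radii keep the diagonal ζ = η away. Expanding with B the potential: the term
B(ζ)f'(ζ)f'(η)/(f ζ - f η) integrates to 0 in η because ζ lies outside; the product term gives (2i)²
times both areas; the remaining term, by the argument principle in ζ, gives 4π times the inner area.
-/
theorem circleIntegral_isoKernel (hf : DifferentiableOn ℂ f (ball 0 1))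
    (hinj : InjOn f (ball 0 1)) {ρ r : ℝ} (hρ : 0 < ρ) (hρr : ρ < r) (hr1 : r < 1) :
    ∮ ζ in C(0, r), ∮ η in C(0, ρ), isoKernel f ζ η
      = 4 * discArea f ρ * (π - discArea f r) := by
  have hr : 0 < r := hρ.trans hρr
  have hρ1 : ρ < 1 := hρr.trans hr1
  have hsr : sphere (0 : ℂ) r ⊆ ball 0 1 :=
    sphere_subset_closedBall.trans (closedBall_subset_ball hr1)
  have hsρ : sphere (0 : ℂ) ρ ⊆ ball 0 1 :=
    sphere_subset_closedBall.trans (closedBall_subset_ball hρ1)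
  have hcf := hf.continuousOn
  have hcd := continuousOn_deriv_ball hf
  have hcB := continuousOn_areaPotential hf
  have hne : ∀ ζ ∈ sphere (0 : ℂ) r, ∀ η ∈ sphere (0 : ℂ) ρ, f ζ - f η ≠ 0 := by
    intro ζ hζ η hη h
    have := hinj (hsr hζ) (hsρ hη) (sub_eq_zero.1 h)
    subst this
    simp only [mem_sphere] at hζ hη
    linarith
  set Q : ℂ → ℂ → ℂ := fun ζ η => areaPotential f η * deriv f η * (deriv f ζ / (f ζ - f η)) with hQ
  have hQc : ContinuousOn (fun p : ℂ × ℂ => Q p.1 p.2) (sphere 0 r ×ˢ sphere 0 ρ) := by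
    have m1 : MapsTo (Prod.fst : ℂ × ℂ → ℂ) (sphere 0 r ×ˢ sphere 0 ρ) (ball 0 1) :=
      fun p hp => hsr hp.1
    have m2 : MapsTo (Prod.snd : ℂ × ℂ → ℂ) (sphere 0 r ×ˢ sphere 0 ρ) (ball 0 1) :=
      fun p hp => hsρ hp.2
    exact ((hcB.comp continuousOn_snd m2).mul (hcd.comp continuousOn_snd m2)).mul
      ((hcd.comp continuousOn_fst m1).div
        ((hcf.comp continuousOn_fst m1).sub (hcf.comp continuousOn_snd m2))
        fun p hp => hne _ hp.1 _ hp.2)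
  have hQη : ∀ ζ ∈ sphere (0 : ℂ) r, CircleIntegrable (Q ζ) 0 ρ := by
    intro ζ hζ
    exact (hQc.comp (f := fun η => (ζ, η)) (by fun_prop)
      fun η hη => ⟨hζ, hη⟩).circleIntegrable hρ.le
  have hBρ : CircleIntegrable (fun η => areaPotential f η * deriv f η) 0 ρ :=
    ((hcB.mul hcd).mono hsρ).circleIntegrable hρ.le
  have hBr : CircleIntegrable (fun η => areaPotential f η * deriv f η) 0 r :=
    ((hcB.mul hcd).mono hsr).circleIntegrable hr.le
  have hinner : EqOn (fun ζ => ∮ η in C(0, ρ), isoKernel f ζ η)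
      (fun ζ => 2 * I * discArea f ρ * (areaPotential f ζ * deriv f ζ) - ∮ η in C(0, ρ), Q ζ η)
      (sphere 0 r) := by
    intro ζ hζ
    have hζ' : ζ ∉ closedBall (0 : ℂ) ρ := by
      simp only [mem_sphere, mem_closedBall] at hζ ⊢
      linarith
    have hD : CircleIntegrable (fun η => deriv f η / (f ζ - f η)) 0 ρ :=
      ((hcd.mono hsρ).div (continuousOn_const.sub (hcf.mono hsρ))
        fun η hη => hne ζ hζ η hη).circleIntegrable hρ.le
    have heq : EqOn (isoKernel f ζ) (fun η =>
        (areaPotential f ζ * deriv f ζ) * (deriv f η / (f ζ - f η)) +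
          (areaPotential f ζ * deriv f ζ) * (areaPotential f η * deriv f η) - Q ζ η)
        (sphere 0 ρ) := by
      intro η hη
      have := hne ζ hζ η hη
      simp only [isoKernel, hQ]
      field_simp
      ring
    have h1 : CircleIntegrable (fun η => (areaPotential f ζ * deriv f ζ) *
        (deriv f η / (f ζ - f η))) 0 ρ := hD.const_smul (a := areaPotential f ζ * deriv f ζ)
    have h2 : CircleIntegrable (fun η => (areaPotential f ζ * deriv f ζ) *
        (areaPotential f η * deriv f η)) 0 ρ := hBρ.const_smul (a := areaPotential f ζ * deriv f ζ)
    simp only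
    rw [circleIntegral.integral_congr hρ.le heq,
      circleIntegral.integral_sub (f := fun η =>
        (areaPotential f ζ * deriv f ζ) * (deriv f η / (f ζ - f η)) +
          (areaPotential f ζ * deriv f ζ) * (areaPotential f η * deriv f η)) (h1.add h2) (hQη ζ hζ),
      circleIntegral.integral_add h1 h2, circleIntegral.integral_const_mul,
      circleIntegral.integral_const_mul,
      circleIntegral_deriv_div_sub_of_notMem hf hinj hρ.le hρ1 (hsr hζ) hζ',
      circleIntegral_areaPotential hf hρ.le hρ1]
    ring
  have hswap : ∮ ζ in C(0, r), ∮ η in C(0, ρ), Q ζ η = -4 * π * discArea f ρ := by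
    rw [circleIntegral_swap hr.le hρ.le hQc]
    have : EqOn (fun η => ∮ ζ in C(0, r), Q ζ η)
        (fun η => 2 * π * I * (areaPotential f η * deriv f η)) (sphere 0 ρ) := by
      intro η hη
      have hηr : η ∈ ball (0 : ℂ) r := by
        simp only [mem_sphere, mem_ball] at hη ⊢
        linarith
      simp only [hQ]
      rw [circleIntegral.integral_const_mul]
      -- If f'(η) = 0 the weight in front already vanishes, so nonvanishing of f' for injective f is
      -- not needed.
      by_cases h0 : deriv f η = 0
      · simp [h0]
      · rw [circleIntegral_deriv_div_sub hf hinj hr1 hηr h0]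
        ring
    rw [circleIntegral.integral_congr hρ.le this, circleIntegral.integral_const_mul,
      circleIntegral_areaPotential hf hρ.le hρ1]
    linear_combination (4 * π * discArea f ρ) * I_mul_I
  have hQout : CircleIntegrable (fun ζ => ∮ η in C(0, ρ), Q ζ η) 0 r := by
    have hc : Continuous fun p : ℝ × ℝ => Q (circleMap 0 r p.1) (circleMap 0 ρ p.2) :=
      hQc.comp_continuous (f := fun p : ℝ × ℝ => (circleMap 0 r p.1, circleMap 0 ρ p.2))
        (by fun_prop) fun p => ⟨circleMap_mem_sphere _ hr.le _, circleMap_mem_sphere _ hρ.le _⟩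
    have : Continuous fun θ : ℝ => ∮ η in C(0, ρ), Q (circleMap 0 r θ) η := by
      simp only [circleIntegral, deriv_circleMap]
      refine intervalIntegral.continuous_parametric_intervalIntegral_of_continuous' ?_ _ _
      have h2 := continuous_circleMap (0 : ℂ) ρ
      exact ((h2.comp continuous_snd).mul continuous_const).smul hc
    exact this.intervalIntegrable _ _
  rw [circleIntegral.integral_congr hr.le hinner, circleIntegral.integral_sub
    (f := fun ζ => 2 * I * discArea f ρ * (areaPotential f ζ * deriv f ζ))
    (hBr.const_smul (a := 2 * I * (discArea f ρ : ℂ))) hQout, hswap,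
    circleIntegral.integral_const_mul, circleIntegral_areaPotential hf hr.le hr1]
  linear_combination (4 * discArea f ρ * discArea f r) * I_mul_I

theorem norm_circleIntegral_le {g : ℂ → ℂ} {b : ℂ → ℝ} {r : ℝ} (hr : 0 ≤ r)
    (hb : ContinuousOn b (sphere 0 r)) (h : ∀ z ∈ sphere (0 : ℂ) r, ‖g z‖ ≤ b z) :
    ‖∮ z in C(0, r), g z‖ ≤ ∫ θ in (0 : ℝ)..2 * π, r * b (circleMap 0 r θ) := by
  have hc : Continuous fun θ => b (circleMap 0 r θ) :=
    hb.comp_continuous (continuous_circleMap 0 r) fun θ => circleMap_mem_sphere _ hr _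
  refine intervalIntegral.norm_integral_le_of_norm_le Real.two_pi_pos.le ?_
    ((continuous_const.mul hc).intervalIntegrable _ _)
  refine Eventually.of_forall fun θ _ => ?_
  rw [norm_smul, deriv_circleMap, norm_mul, norm_I, mul_one, norm_circleMap_zero, abs_of_nonneg hr]
  exact mul_le_mul_of_nonneg_left (h _ (circleMap_mem_sphere _ hr _)) hr

theorem discArea_mul_le_circleLength_mul (hf : DifferentiableOn ℂ f (ball 0 1))
    (hinj : InjOn f (ball 0 1)) {ρ r : ℝ} (hρ : 0 < ρ) (hρr : ρ < r) (hr1 : r < 1) :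
    4 * discArea f ρ * (π - discArea f r) ≤ circleLength f r * circleLength f ρ := by
  have hr : 0 < r := hρ.trans hρr
  have hρ1 : ρ < 1 := hρr.trans hr1
  have hsr : sphere (0 : ℂ) r ⊆ ball 0 1 :=
    sphere_subset_closedBall.trans (closedBall_subset_ball hr1)
  have hsρ : sphere (0 : ℂ) ρ ⊆ ball 0 1 :=
    sphere_subset_closedBall.trans (closedBall_subset_ball hρ1)
  have hcs := continuousOn_sph hf
  have h := circleIntegral_isoKernel hf hinj hρ hρr hr1
  have hb : ‖∮ ζ in C(0, r), ∮ η in C(0, ρ), isoKernel f ζ η‖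
      ≤ ∫ θ in (0 : ℝ)..2 * π, r * (sph f (circleMap 0 r θ) * circleLength f ρ) := by
    refine norm_circleIntegral_le (b := fun z => sph f z * circleLength f ρ) hr.le
      ((hcs.mono hsr).mul continuousOn_const) fun ζ hζ => ?_
    refine (norm_circleIntegral_le (b := fun z => sph f ζ * sph f z) hρ.le
      (continuousOn_const.mul (hcs.mono hsρ)) fun η hη => ?_).trans ?_
    · refine (norm_isoKernel fun h => ?_).le
      have := hinj (hsr hζ) (hsρ hη) h
      subst this
      simp only [mem_sphere] at hζ hη
      linarith
    · rw [circleLength, ← intervalIntegral.integral_const_mul]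
      refine le_of_eq (intervalIntegral.integral_congr fun θ _ => ?_)
      ring
  rw [h] at hb
  have e : (∫ θ in (0 : ℝ)..2 * π, r * (sph f (circleMap 0 r θ) * circleLength f ρ))
      = circleLength f r * circleLength f ρ := by
    generalize circleLength f ρ = c
    rw [circleLength, ← intervalIntegral.integral_mul_const]
    refine intervalIntegral.integral_congr fun θ _ => ?_
    ring
  rw [e] at hb
  refine le_trans ?_ hb
  have : (4 * discArea f ρ * (π - discArea f r) : ℂ)
      = ((4 * discArea f ρ * (π - discArea f r) : ℝ) : ℂ) := by push_cast; rfl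
  rw [this, norm_real]
  exact le_abs_self _

/-! ### Dependence on the radius, and Cauchy-Schwarz on circles. -/

theorem continuousOn_circleMean {g : ℂ → ℝ} (hg : ContinuousOn g (ball 0 1)) :
    ContinuousOn (fun t : ℝ => ∫ θ in (0 : ℝ)..2 * π, g (circleMap 0 t θ)) (Ioo (-1) 1) := by
  intro t ht
  -- Clamping the radius to [-R, R] makes the integrand continuous on all of ℝ × ℝ without changing
  -- it near t.
  obtain ⟨R, htR, hR1⟩ := exists_between (abs_lt.2 ht)
  have hR : -R ≤ R := by linarith [abs_nonneg t]
  have hc : Continuous fun p : ℝ × ℝ => g (circleMap 0 (projIcc (-R) R hR p.1) p.2) := by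
    refine hg.comp_continuous (f := fun p : ℝ × ℝ => circleMap 0 (projIcc (-R) R hR p.1) p.2)
      (continuous_circleMap_uncurry.comp (f := fun p : ℝ × ℝ => ((projIcc (-R) R hR p.1 : ℝ), p.2))
        (by fun_prop)) fun p => ?_
    have := (projIcc (-R) R hR p.1).2
    simpa using (abs_le.2 this).trans_lt hR1
  have h1 := intervalIntegral.continuous_parametric_intervalIntegral_of_continuous' (μ := volume)
    (f := fun t θ => g (circleMap 0 (projIcc (-R) R hR t) θ)) hc 0 (2 * π)
  refine (h1.continuousAt.congr ?_).continuousWithinAt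
  filter_upwards [Ioo_mem_nhds (abs_lt.1 htR).1 (abs_lt.1 htR).2] with s hs
  rw [projIcc_of_mem hR (Ioo_subset_Icc_self hs)]

theorem continuousOn_circleEnergy (hf : DifferentiableOn ℂ f (ball 0 1)) :
    ContinuousOn (circleEnergy f) (Ioo (-1) 1) :=
  continuousOn_circleMean ((continuousOn_sph hf).pow 2)

theorem continuousOn_circleLength (hf : DifferentiableOn ℂ f (ball 0 1)) :
    ContinuousOn (circleLength f) (Ioo (-1) 1) := by
  have : circleLength f = fun r => r * ∫ θ in (0 : ℝ)..2 * π, sph f (circleMap 0 r θ) := by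
    funext r
    rw [circleLength, intervalIntegral.integral_const_mul]
  rw [this]
  exact continuousOn_id.mul (continuousOn_circleMean (continuousOn_sph hf))

theorem hasDerivAt_discArea (hf : DifferentiableOn ℂ f (ball 0 1)) {r : ℝ} (hr : r ∈ Ioo (-1 : ℝ) 1) :
    HasDerivAt (discArea f) (r * circleEnergy f r) r := by
  have hc : ContinuousOn (fun t => t * circleEnergy f t) (Ioo (-1) 1) :=
    continuousOn_id.mul (continuousOn_circleEnergy hf)
  refine intervalIntegral.integral_hasDerivAt_right ?_ ?_ (hc.continuousAt (isOpen_Ioo.mem_nhds hr))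
  · refine (hc.mono ?_).intervalIntegrable
    exact (ordConnected_Ioo.uIcc_subset (by constructor <;> norm_num) hr)
  · exact hc.stronglyMeasurableAtFilter isOpen_Ioo r hr

/-- The spherical isoperimetric inequality for images of disks under injective holomorphic maps. -/
theorem isoperimetric (hf : DifferentiableOn ℂ f (ball 0 1))
    (hinj : InjOn f (ball 0 1)) {r : ℝ} (hr : 0 < r) (hr1 : r < 1) :
    4 * discArea f r * (π - discArea f r) ≤ circleLength f r ^ 2 := by
  have hmem : r ∈ Ioo (-1 : ℝ) 1 := ⟨by linarith, hr1⟩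
  have ha : Tendsto (discArea f) (𝓝[<] r) (𝓝 (discArea f r)) :=
    (hasDerivAt_discArea hf hmem).continuousAt.continuousWithinAt
  have hL : Tendsto (circleLength f) (𝓝[<] r) (𝓝 (circleLength f r)) :=
    ((continuousOn_circleLength hf).continuousAt (isOpen_Ioo.mem_nhds hmem)).continuousWithinAt
  rw [sq]
  refine le_of_tendsto_of_tendsto ((ha.const_mul 4).mul_const (π - discArea f r))
    (hL.const_mul (circleLength f r)) ?_
  filter_upwards [Ioo_mem_nhdsLT hr] with ρ hρ
  exact discArea_mul_le_circleLength_mul hf hinj hρ.1 hρ.2 hr1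

/-- The Cauchy-Schwarz inequality on a circle, with the deficit as an integral. -/
theorem circleEnergy_eq (hf : DifferentiableOn ℂ f (ball 0 1)) {r : ℝ} (hr : 0 ≤ r) (hr1 : r < 1)
    (c : ℝ) :
    ∫ θ in (0 : ℝ)..2 * π, (r * sph f (circleMap 0 r θ) - c) ^ 2
      = r ^ 2 * circleEnergy f r - 2 * c * circleLength f r + 2 * π * c ^ 2 := by
  have hc : Continuous fun θ => sph f (circleMap 0 r θ) :=
    (continuousOn_sph hf).comp_continuous (continuous_circleMap 0 r)
      fun θ => circleMap_zero_mem_ball hr hr1 θ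
  have e : ∀ θ : ℝ, (r * sph f (circleMap 0 r θ) - c) ^ 2
      = r ^ 2 * sph f (circleMap 0 r θ) ^ 2 - 2 * c * (r * sph f (circleMap 0 r θ)) + c ^ 2 := by
    intro θ
    ring
  simp_rw [e]
  rw [intervalIntegral.integral_add, intervalIntegral.integral_sub,
    intervalIntegral.integral_const_mul, intervalIntegral.integral_const_mul,
    intervalIntegral.integral_const, circleEnergy, circleLength]
  · simp
  all_goals exact Continuous.intervalIntegrable (by fun_prop) _ _

/-- The variance of r·f♯ about its mean L/(2π) is nonnegative. -/
theorem sq_circleLength_le (hf : DifferentiableOn ℂ f (ball 0 1)) {r : ℝ} (hr : 0 ≤ r)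
    (hr1 : r < 1) : circleLength f r ^ 2 ≤ 2 * π * (r ^ 2 * circleEnergy f r) := by
  have h := circleEnergy_eq hf hr hr1 (circleLength f r / (2 * π))
  have h0 : 0 ≤ ∫ θ in (0 : ℝ)..2 * π,
      (r * sph f (circleMap 0 r θ) - circleLength f r / (2 * π)) ^ 2 :=
    intervalIntegral.integral_nonneg Real.two_pi_pos.le fun θ _ => sq_nonneg _
  rw [h] at h0
  have hpi := Real.pi_pos
  have e : 2 * π * (r ^ 2 * circleEnergy f r) - circleLength f r ^ 2 = 2 * π *
      (r ^ 2 * circleEnergy f r - 2 * (circleLength f r / (2 * π)) * circleLength f r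
        + 2 * π * (circleLength f r / (2 * π)) ^ 2) := by
    field_simp
    ring
  have := mul_nonneg Real.two_pi_pos.le h0
  linarith

end

/-! ### The area of the sphere, and the half-sphere bound. -/

theorem hasDerivAt_diskArea_formula (t : ℝ) :
    HasDerivAt (fun t : ℝ => π * t ^ 2 / (1 + t ^ 2)) (t * (2 * π * (1 / (1 + t ^ 2) ^ 2))) t := by
  have hne : (1 + t ^ 2 : ℝ) ≠ 0 := by positivity
  have h1 : HasDerivAt (fun t : ℝ => t ^ 2) (2 * t) t := by simpa using hasDerivAt_pow 2 t
  refine ((h1.const_mul π).div (h1.const_add 1) hne).congr_deriv ?_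
  field_simp
  ring

theorem continuous_inv_one_add_norm_sq_sq :
    Continuous fun z : ℂ => 1 / (1 + ‖z‖ ^ 2) ^ 2 := by
  have : ∀ z : ℂ, (1 + ‖z‖ ^ 2) ^ 2 ≠ 0 := fun z => by positivity
  fun_prop (disch := assumption)

theorem diskArea_eq {r : ℝ} (hr : 0 ≤ r) :
    diskArea r = ENNReal.ofReal (π * r ^ 2 / (1 + r ^ 2)) := by
  rw [diskArea, setLIntegral_ball_eq_polar (g := fun z => 1 / (1 + ‖z‖ ^ 2) ^ 2) hr
    continuous_inv_one_add_norm_sq_sq.continuousOn fun z => by positivity]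
  congr 1
  have h : ∀ t : ℝ, t * ∫ θ in (0 : ℝ)..2 * π, 1 / (1 + ‖circleMap 0 t θ‖ ^ 2) ^ 2
      = t * (2 * π * (1 / (1 + t ^ 2) ^ 2)) := by
    intro t
    simp
  simp_rw [h]
  rw [intervalIntegral.integral_eq_sub_of_hasDerivAt (fun t _ => hasDerivAt_diskArea_formula t)]
  · simp
  · refine Continuous.intervalIntegrable ?_ _ _
    have : ∀ t : ℝ, (1 + t ^ 2) ^ 2 ≠ 0 := fun z => by positivity
    fun_prop (disch := assumption)

/-- The density of the spherical area in the plane. -/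
noncomputable def sphereDensity (w : ℂ) : ENNReal := ENNReal.ofReal (1 / (1 + ‖w‖ ^ 2) ^ 2)

theorem lintegral_sphereDensity_le : ∫⁻ w, sphereDensity w ≤ ENNReal.ofReal π := by
  have hU : (⋃ n : ℕ, ball (0 : ℂ) n) = univ := iUnion_ball_nat 0
  rw [← setLIntegral_univ, ← hU, setLIntegral_iUnion_of_directed]
  · refine iSup_le fun n => ?_
    have := diskArea_eq (r := n) n.cast_nonneg
    rw [diskArea] at this
    refine this.le.trans (ENNReal.ofReal_le_ofReal ?_)
    rw [div_le_iff₀ (by positivity)]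
    nlinarith [Real.pi_pos]
  · exact directed_of_isDirected_le fun m n hmn => ball_subset_ball (by exact_mod_cast hmn)

/-- Change of variables: the real Jacobian of a holomorphic map is |h'|². -/
theorem lintegral_sphereDensity_image {h : ℂ → ℂ} {U : Set ℂ} (hU : IsOpen U)
    (hh : DifferentiableOn ℂ h U) (hinj : InjOn h U) :
    ∫⁻ w in h '' U, sphereDensity w = ∫⁻ z in U, ENNReal.ofReal (sph h z ^ 2) := by
  rw [lintegral_image_eq_lintegral_abs_det_fderiv_mul volume hU.measurableSet
    (f' := fun z => (ContinuousLinearMap.toSpanSingleton ℂ (deriv h z)).restrictScalars ℝ)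
    (fun z hz => ((hh.differentiableAt (hU.mem_nhds hz)).hasDerivAt.hasFDerivAt.restrictScalars
      ℝ).hasFDerivWithinAt) hinj]
  refine setLIntegral_congr_fun hU.measurableSet fun z _ => ?_
  have hdet : ((ContinuousLinearMap.toSpanSingleton ℂ (deriv h z)).restrictScalars ℝ).det
      = ‖deriv h z‖ ^ 2 := by
    rw [ContinuousLinearMap.det, ContinuousLinearMap.coe_restrictScalars,
      LinearMap.det_restrictScalars, Algebra.norm_complex_apply, normSq_eq_norm_sq]
    congr 2
    have : ((ContinuousLinearMap.toSpanSingleton ℂ (deriv h z) : ℂ →L[ℂ] ℂ) : ℂ →ₗ[ℂ] ℂ)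
        = deriv h z • LinearMap.id := by
      ext; simp
    rw [this, LinearMap.det_smul]
    simp
  simp only [hdet, sphereDensity]
  rw [← ENNReal.ofReal_mul (abs_nonneg _), abs_of_nonneg (by positivity), sph, div_pow,
    mul_one_div]

theorem sph_inv {f : ℂ → ℂ} {z : ℂ} (hd : DifferentiableAt ℂ f z) (h0 : f z ≠ 0) :
    sph (fun z => (f z)⁻¹) z = sph f z := by
  have hn : ‖f z‖ ≠ 0 := norm_ne_zero_iff.2 h0
  have h1 : deriv (fun z => (f z)⁻¹) z = -deriv f z / f z ^ 2 := (hd.hasDerivAt.inv h0).deriv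
  rw [sph, sph, h1, norm_div, norm_neg, norm_pow, norm_inv]
  field_simp
  ring

/-- The image of a map without antipodal values has at most half of the area of the sphere. -/
theorem lintegral_sph_sq_le {f : ℂ → ℂ} (hf : DifferentiableOn ℂ f (ball 0 1))
    (hinj : InjOn f (ball 0 1))
    (hanti : ∀ z ∈ ball (0 : ℂ) 1, ∀ w ∈ ball (0 : ℂ) 1, 1 + f z * conj (f w) ≠ 0) :
    ∫⁻ z in ball (0 : ℂ) 1, ENNReal.ofReal (sph f z ^ 2) ≤ ENNReal.ofReal (π / 2) := by
  set A := ∫⁻ z in ball (0 : ℂ) 1, ENNReal.ofReal (sph f z ^ 2) with hA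
  -- Removing the zeros of f makes 1/f holomorphic; by injectivity at most one point is lost.
  set U : Set ℂ := ball (0 : ℂ) 1 ∩ f ⁻¹' {0}ᶜ with hU
  have hUo : IsOpen U := hf.continuousOn.isOpen_inter_preimage isOpen_ball isOpen_compl_singleton
  set g : ℂ → ℂ := fun z => (f z)⁻¹ with hg
  have hgd : DifferentiableOn ℂ g U := (hf.mono inter_subset_left).inv fun z hz => hz.2
  have hgi : InjOn g U := fun z hz w hw h => hinj hz.1 hw.1 (inv_injective h)
  have h1 : ∫⁻ w in f '' ball 0 1, sphereDensity w = A :=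
    lintegral_sphereDensity_image isOpen_ball hf hinj
  have h2 : ∫⁻ w in g '' U, sphereDensity w = A := by
    rw [lintegral_sphereDensity_image hUo hgd hgi]
    have e1 : ∫⁻ z in U, ENNReal.ofReal (sph g z ^ 2) = ∫⁻ z in U, ENNReal.ofReal (sph f z ^ 2) := by
      refine setLIntegral_congr_fun hUo.measurableSet fun z hz => ?_
      rw [hg, sph_inv (hf.differentiableAt (isOpen_ball.mem_nhds hz.1)) hz.2]
    rw [e1]
    refine setLIntegral_congr ?_
    have hsub : (ball (0 : ℂ) 1 \ U).Subsingleton := by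
      rintro z ⟨hz, hz'⟩ w ⟨hw, hw'⟩
      simp only [hU, mem_inter_iff, mem_preimage, mem_compl_iff, mem_singleton_iff, not_and,
        not_not] at hz' hw'
      exact hinj hz hw ((hz' hz).trans (hw' hw).symm)
    exact (ae_eq_set.2 ⟨by rw [sdiff_eq_empty.2 inter_subset_left]; simp,
      hsub.measure_zero volume⟩)
  -- w ↦ -conj w. Applied to the values 1/f it gives -1/conj f, the antipodal image of f(U), which
  -- the hypothesis makes disjoint from f(D).
  set J : ℂ ≃ₗᵢ[ℝ] ℂ := conjLIE.trans (LinearIsometryEquiv.neg ℝ) with hJ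
  have hJn : ∀ w, sphereDensity (J w) = sphereDensity w := fun w => by
    rw [sphereDensity, J.norm_map, sphereDensity]
  have h3 : ∫⁻ w in J '' (g '' U), sphereDensity w = A := by
    rw [← J.measurePreserving.setLIntegral_comp_emb
      J.toHomeomorph.measurableEmbedding sphereDensity]
    simp_rw [hJn]
    exact h2
  have hfo : MeasurableSet (J '' (g '' U)) := by
    refine J.toHomeomorph.measurableEmbedding.measurableSet_image.2 ?_
    exact hUo.measurableSet.image_of_continuousOn_injOn hgd.continuousOn hgi
  have hdisj : Disjoint (f '' ball 0 1) (J '' (g '' U)) := by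
    rw [disjoint_left]
    rintro _ ⟨z, hz, rfl⟩ ⟨_, ⟨w, hw, rfl⟩, h⟩
    refine hanti z hz w hw.1 ?_
    have hw0 : conj (f w) ≠ 0 := (map_ne_zero _).2 hw.2
    have : f z = -(conj (f w))⁻¹ := by
      rw [← h]
      simp [hJ, hg]
    rw [this]
    field_simp
    ring
  have h4 : A + A ≤ ENNReal.ofReal π := by
    calc A + A = ∫⁻ w in f '' ball 0 1 ∪ J '' (g '' U), sphereDensity w := by
          rw [lintegral_union hfo hdisj, h1, h3]
      _ ≤ ∫⁻ w, sphereDensity w := setLIntegral_le_lintegral _ _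
      _ ≤ _ := lintegral_sphereDensity_le
  rw [show π = π / 2 + π / 2 by ring, ENNReal.ofReal_add (by positivity) (by positivity),
    ← two_mul, ← two_mul] at h4
  exact (ENNReal.mul_le_mul_iff_right (by simp) (by simp)).1 h4

/-! ### Monotonicity of the area ratio, and equality on an annulus. -/

section

variable {f : ℂ → ℂ}

theorem lintegral_sph_sq_eq_discArea (hf : DifferentiableOn ℂ f (ball 0 1)) {r : ℝ} (hr : 0 ≤ r)
    (hr1 : r < 1) :
    ∫⁻ z in ball (0 : ℂ) r, ENNReal.ofReal (sph f z ^ 2) = ENNReal.ofReal (discArea f r) :=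
  setLIntegral_ball_eq_polar hr
    (((continuousOn_sph hf).pow 2).mono (closedBall_subset_ball hr1)) fun _ => sq_nonneg _

theorem discArea_nonneg {r : ℝ} (hr : 0 ≤ r) : 0 ≤ discArea f r := by
  refine intervalIntegral.integral_nonneg hr fun t ht => mul_nonneg ht.1 ?_
  exact intervalIntegral.integral_nonneg Real.two_pi_pos.le fun θ _ => sq_nonneg _

theorem discArea_le_pi_div_two (hf : DifferentiableOn ℂ f (ball 0 1))
    (hinj : InjOn f (ball 0 1))
    (hanti : ∀ z ∈ ball (0 : ℂ) 1, ∀ w ∈ ball (0 : ℂ) 1, 1 + f z * conj (f w) ≠ 0)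
    {r : ℝ} (hr : 0 ≤ r) (hr1 : r < 1) : discArea f r ≤ π / 2 := by
  rw [← ENNReal.ofReal_le_ofReal_iff (by positivity), ← lintegral_sph_sq_eq_discArea hf hr hr1]
  exact (lintegral_mono_set (ball_subset_ball hr1.le)).trans (lintegral_sph_sq_le hf hinj hanti)

/-- With A' = rE, E the circle energy, the numerator of the derivative is r(πr²E - 2A(π - A)). It is
nonnegative because 4A(π - A) ≤ L² ≤ 2πr²E. For the disk itself the ratio is constantly 1. -/
theorem monotoneOn_area_ratio (hf : DifferentiableOn ℂ f (ball 0 1)) (hinj : InjOn f (ball 0 1))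
    (hanti : ∀ z ∈ ball (0 : ℂ) 1, ∀ w ∈ ball (0 : ℂ) 1, 1 + f z * conj (f w) ≠ 0) :
    MonotoneOn (fun r => discArea f r / ((π - discArea f r) * r ^ 2)) (Ioo 0 1) := by
  have hpi := Real.pi_pos
  have hlt : ∀ r ∈ Ioo (0 : ℝ) 1, 0 < π - discArea f r := fun r hr => by
    linarith [discArea_le_pi_div_two hf hinj hanti hr.1.le hr.2]
  have hd : ∀ r ∈ Ioo (0 : ℝ) 1, HasDerivAt
      (fun r => discArea f r / ((π - discArea f r) * r ^ 2))
      (r * (π * (r ^ 2 * circleEnergy f r) - 2 * discArea f r * (π - discArea f r))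
        / ((π - discArea f r) * r ^ 2) ^ 2) r := by
    intro r hr
    have h1 := hasDerivAt_discArea hf (r := r) ⟨by linarith [hr.1], hr.2⟩
    have h2 : HasDerivAt (fun t : ℝ => t ^ 2) (2 * r) r := by simpa using hasDerivAt_pow 2 r
    have hne : (π - discArea f r) * r ^ 2 ≠ 0 :=
      (mul_pos (hlt r hr) (pow_pos hr.1 2)).ne'
    refine (h1.div ((h1.const_sub π).mul h2) hne).congr_deriv ?_
    simp only [Pi.mul_apply]
    ring
  refine monotoneOn_of_deriv_nonneg (convex_Ioo 0 1)
    (fun r hr => (hd r hr).continuousAt.continuousWithinAt)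
    (fun r hr => ?_) fun r hr => ?_
  · rw [interior_Ioo] at hr
    exact (hd r hr).differentiableAt.differentiableWithinAt
  · rw [interior_Ioo] at hr
    rw [(hd r hr).deriv]
    have h3 := isoperimetric hf hinj hr.1 hr.2
    have h4 := sq_circleLength_le hf hr.1.le hr.2
    exact div_nonneg (mul_nonneg hr.1.le (by linarith)) (sq_nonneg _)

theorem area_ratio_le_one (hf : DifferentiableOn ℂ f (ball 0 1)) (hinj : InjOn f (ball 0 1))
    (hanti : ∀ z ∈ ball (0 : ℂ) 1, ∀ w ∈ ball (0 : ℂ) 1, 1 + f z * conj (f w) ≠ 0)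
    {r : ℝ} (hr : 0 < r) (hr1 : r < 1) :
    discArea f r / ((π - discArea f r) * r ^ 2) ≤ 1 := by
  have hpi := Real.pi_pos
  have ht : Tendsto (fun t : ℝ => 1 / t ^ 2) (𝓝[<] 1) (𝓝 1) := by
    have : ContinuousAt (fun t : ℝ => 1 / t ^ 2) 1 := by
      refine continuousAt_const.div (by fun_prop) (by norm_num)
    simpa using this.continuousWithinAt.tendsto
  refine ge_of_tendsto ht ?_
  filter_upwards [Ioo_mem_nhdsLT hr1] with t ht
  have ht0 : 0 < t := hr.trans ht.1
  have h2 := discArea_le_pi_div_two hf hinj hanti ht0.le ht.2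
  refine (monotoneOn_area_ratio hf hinj hanti ⟨hr, hr1⟩ ⟨ht0, ht.2⟩ ht.1.le).trans ?_
  have h3 : 0 < π - discArea f t := by linarith
  simp only
  rw [div_le_div_iff₀ (by positivity) (by positivity)]
  nlinarith [sq_nonneg t]

theorem discArea_le (hf : DifferentiableOn ℂ f (ball 0 1)) (hinj : InjOn f (ball 0 1))
    (hanti : ∀ z ∈ ball (0 : ℂ) 1, ∀ w ∈ ball (0 : ℂ) 1, 1 + f z * conj (f w) ≠ 0)
    {r : ℝ} (hr : 0 < r) (hr1 : r < 1) : discArea f r ≤ π * r ^ 2 / (1 + r ^ 2) := by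
  have hpi := Real.pi_pos
  have h1 := area_ratio_le_one hf hinj hanti hr hr1
  have h2 := discArea_le_pi_div_two hf hinj hanti hr.le hr1
  have h3 : 0 < π - discArea f r := by linarith
  rw [div_le_one (by positivity)] at h1
  rw [le_div_iff₀ (by positivity)]
  linarith

/-- Once the ratio reaches its upper bound 1, monotonicity keeps it there. -/
theorem discArea_eq_of_eq (hf : DifferentiableOn ℂ f (ball 0 1)) (hinj : InjOn f (ball 0 1))
    (hanti : ∀ z ∈ ball (0 : ℂ) 1, ∀ w ∈ ball (0 : ℂ) 1, 1 + f z * conj (f w) ≠ 0)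
    {r t : ℝ} (hr : 0 < r) (hrt : r < t) (ht1 : t < 1)
    (heq : discArea f r = π * r ^ 2 / (1 + r ^ 2)) :
    discArea f t = π * t ^ 2 / (1 + t ^ 2) := by
  have hpi := Real.pi_pos
  have ht0 := hr.trans hrt
  refine le_antisymm (discArea_le hf hinj hanti ht0 ht1) ?_
  have h := monotoneOn_area_ratio hf hinj hanti ⟨hr, hrt.trans ht1⟩ ⟨ht0, ht1⟩ hrt.le
  have h1 : discArea f r / ((π - discArea f r) * r ^ 2) = 1 := by
    rw [heq, show π - π * r ^ 2 / (1 + r ^ 2) = π / (1 + r ^ 2) by field_simp; ring]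
    field_simp
  have h2 := discArea_le_pi_div_two hf hinj hanti ht0.le ht1
  have h3 : 0 < π - discArea f t := by linarith
  simp only [h1] at h
  rw [le_div_iff₀ (by positivity)] at h
  rw [div_le_iff₀ (by positivity)]
  linarith

theorem sph_eq_of_discArea_eq (hf : DifferentiableOn ℂ f (ball 0 1)) (hinj : InjOn f (ball 0 1))
    (hanti : ∀ z ∈ ball (0 : ℂ) 1, ∀ w ∈ ball (0 : ℂ) 1, 1 + f z * conj (f w) ≠ 0)
    {r : ℝ} (hr : 0 < r) (heq : discArea f r = π * r ^ 2 / (1 + r ^ 2)) {z : ℂ}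
    (hrz : r < ‖z‖) (hz1 : ‖z‖ < 1) : sph f z = 1 / (1 + ‖z‖ ^ 2) := by
  have hpi := Real.pi_pos
  obtain ⟨t, ht⟩ : ∃ t, t = ‖z‖ := ⟨_, rfl⟩
  rw [← ht] at hrz hz1 ⊢
  have ht0 : 0 < t := hr.trans hrz
  have ha := discArea_eq_of_eq hf hinj hanti hr hrz hz1 heq
  -- The two area functions agree on a neighbourhood of t, so their derivatives agree at t.
  have hE : t * circleEnergy f t = t * (2 * π * (1 / (1 + t ^ 2) ^ 2)) := by
    have h1 := hasDerivAt_discArea hf (r := t) ⟨by linarith, hz1⟩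
    refine h1.unique ((hasDerivAt_diskArea_formula t).congr_of_eventuallyEq ?_)
    filter_upwards [Ioo_mem_nhds hrz hz1] with s hs
    exact discArea_eq_of_eq hf hinj hanti hr hs.1 hs.2 heq
  have hL : 2 * π * (t / (1 + t ^ 2)) ≤ circleLength f t := by
    refine abs_le_of_sq_le_sq' ?_ ?_ |>.2
    · refine le_trans (le_of_eq ?_) (isoperimetric hf hinj ht0 hz1)
      rw [ha]
      field_simp
      ring
    · exact intervalIntegral.integral_nonneg Real.two_pi_pos.le fun θ _ =>
        mul_nonneg ht0.le (sph_nonneg _ _)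
  -- The constant t/(1+t²) is the value of t·f♯ for an isometry. With hE and hL the mean square
  -- deviation from it is at most 0, so continuity forces pointwise equality.
  have hint := circleEnergy_eq hf ht0.le hz1 (t / (1 + t ^ 2))
  have hle : ∫ θ in (0 : ℝ)..2 * π, (t * sph f (circleMap 0 t θ) - t / (1 + t ^ 2)) ^ 2 ≤ 0 := by
    rw [hint, sq t, mul_assoc, hE]
    have hc : 0 < t / (1 + t ^ 2) := by positivity
    have e : t * (t * (2 * π * (1 / (1 + t ^ 2) ^ 2))) = 2 * π * (t / (1 + t ^ 2)) ^ 2 := by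
      field_simp
    rw [← sq, e]
    nlinarith [mul_le_mul_of_nonneg_left hL hc.le]
  have hzm : z ∈ circleMap 0 t '' Ioc 0 (2 * π) := by
    rw [image_circleMap_Ioc, abs_of_pos ht0]
    simp [ht]
  obtain ⟨θ, hθ, rfl⟩ := hzm
  by_contra hne
  have hc : Continuous fun θ => sph f (circleMap 0 t θ) :=
    (continuousOn_sph hf).comp_continuous (continuous_circleMap 0 t)
      fun θ => circleMap_zero_mem_ball ht0.le hz1 θ
  refine hle.not_gt (intervalIntegral.integral_pos Real.two_pi_pos
    (Continuous.continuousOn (by fun_prop)) (fun _ _ => sq_nonneg _)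
    ⟨θ, Ioc_subset_Icc_self hθ, ?_⟩)
  refine sq_pos_of_ne_zero fun h => hne ?_
  have h' : t * sph f (circleMap 0 t θ) = t * (1 / (1 + t ^ 2)) := by
    rw [mul_one_div]
    linarith
  exact mul_left_cancel₀ ht0.ne' h'

end

/-! ### Rigidity: the spherical derivative of an isometry determines a Möbius map. -/

/-- A real-linear map `v ↦ a v + b conj v` vanishes only if `a = b = 0`. -/
theorem eq_zero_of_forall_mul_add_mul_conj {a b : ℂ} (h : ∀ v : ℂ, a * v + b * conj v = 0) :
    a = 0 ∧ b = 0 := by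
  have h1 := h 1
  have h2 := h I
  simp only [map_one, conj_I] at h1 h2
  have h3 : a - b = 0 := by
    have : (a - b) * I = 0 := by linear_combination h2
    exact (mul_eq_zero.1 this).resolve_right I_ne_zero
  constructor
  · linear_combination h1 / 2 + h3 / 2
  · linear_combination h1 / 2 - h3 / 2

theorem hasFDerivAt_mul_conj {u w : ℂ → ℂ} {z : ℂ} (hu : DifferentiableAt ℂ u z)
    (hw : DifferentiableAt ℂ w z) :
    HasFDerivAt (fun z => u z * conj (w z))
      ((deriv u z * conj (w z)) • (ContinuousLinearMap.id ℝ ℂ)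
        + (u z * conj (deriv w z)) • (conjCLE : ℂ →L[ℝ] ℂ)) z := by
  have h1 := hu.hasDerivAt.hasFDerivAt.restrictScalars ℝ
  have h2 := (conjCLE : ℂ →L[ℝ] ℂ).hasFDerivAt.comp z
    (hw.hasDerivAt.hasFDerivAt.restrictScalars ℝ)
  refine (h1.mul h2).congr_fderiv ?_
  ext
  simp
  ring

/-- If `|p|² + |q|² = c + k |z|²` for holomorphic `p` and `q`, then `p' conj p + q' conj q = k conj z`
and `|p'|² + |q'|² = k`. -/
theorem deriv_mul_conj_of_norm_sq_add {p q : ℂ → ℂ} {V : Set ℂ} (hV : IsOpen V)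
    (hp : DifferentiableOn ℂ p V) (hq : DifferentiableOn ℂ q V) {c k : ℂ}
    (h : ∀ z ∈ V, p z * conj (p z) + q z * conj (q z) = c + k * (z * conj z)) :
    (∀ z ∈ V, deriv p z * conj (p z) + deriv q z * conj (q z) = k * conj z) ∧
    ∀ z ∈ V, deriv p z * conj (deriv p z) + deriv q z * conj (deriv q z) = k := by
  -- The polarized form, with the holomorphic and the conjugated factors independent, can be applied
  -- a second time after one factor has been differentiated.
  have key : ∀ {p₁ p₂ q₁ q₂ w₁ : ℂ → ℂ} {c : ℂ}, DifferentiableOn ℂ p₁ V →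
      DifferentiableOn ℂ p₂ V → DifferentiableOn ℂ q₁ V → DifferentiableOn ℂ q₂ V →
      DifferentiableOn ℂ w₁ V →
      (∀ z ∈ V, p₁ z * conj (p₂ z) + q₁ z * conj (q₂ z) = c + w₁ z * conj z) →
      ∀ z ∈ V, deriv p₁ z * conj (p₂ z) + deriv q₁ z * conj (q₂ z) = deriv w₁ z * conj z ∧
        p₁ z * conj (deriv p₂ z) + q₁ z * conj (deriv q₂ z) = w₁ z := by
    intro p₁ p₂ q₁ q₂ w₁ c hp₁ hp₂ hq₁ hq₂ hw₁ h z hz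
    have hn := hV.mem_nhds hz
    have d1 := (hasFDerivAt_mul_conj (hp₁.differentiableAt hn) (hp₂.differentiableAt hn)).add
      (hasFDerivAt_mul_conj (hq₁.differentiableAt hn) (hq₂.differentiableAt hn))
    have d2 := (hasFDerivAt_mul_conj (hw₁.differentiableAt hn)
      (differentiableAt_id (𝕜 := ℂ) (x := z))).const_add c
    have d3 := d1.unique (d2.congr_of_eventuallyEq (by
      filter_upwards [hn] with w hw
      exact h w hw))
    have d4 := eq_zero_of_forall_mul_add_mul_conj
      (a := deriv p₁ z * conj (p₂ z) + deriv q₁ z * conj (q₂ z) - deriv w₁ z * conj z)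
      (b := p₁ z * conj (deriv p₂ z) + q₁ z * conj (deriv q₂ z) - w₁ z) (fun v => by
        have := congrArg (fun L : ℂ →L[ℝ] ℂ => L v) d3
        simp at this
        linear_combination this)
    exact ⟨sub_eq_zero.1 d4.1, sub_eq_zero.1 d4.2⟩
  have hk : DifferentiableOn ℂ (fun z => k * z) V := by fun_prop
  have h1 : ∀ z ∈ V, deriv p z * conj (p z) + deriv q z * conj (q z) = k * conj z := by
    intro z hz
    have := (key (w₁ := fun z => k * z) (c := c) hp hp hq hq hk (fun z hz => by
      rw [h z hz]
      ring) z hz).1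
    rwa [deriv_const_mul _ differentiableAt_id, deriv_id'', mul_one] at this
  refine ⟨h1, fun z hz => ?_⟩
  exact (key (w₁ := fun _ => k) (c := 0) (hp.deriv hV) hp (hq.deriv hV) hq
    (differentiableOn_const _) (fun z hz => by rw [h1 z hz, zero_add]) z hz).2

theorem mul_conj_add_mul_conj_eq_zero {a b : ℂ} (h : a * conj a + b * conj b = 0) :
    a = 0 ∧ b = 0 := by
  rw [mul_conj, mul_conj] at h
  have h' : normSq a + normSq b = 0 := by exact_mod_cast h
  have h1 := normSq_nonneg a
  have h2 := normSq_nonneg b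
  exact ⟨normSq_eq_zero.1 (by linarith), normSq_eq_zero.1 (by linarith)⟩

theorem exists_affine_of_deriv_deriv_eq_zero {p : ℂ → ℂ} {V : Set ℂ} (hV : IsOpen V)
    (hVc : IsPreconnected V) (hp : DifferentiableOn ℂ p V)
    (h : ∀ z ∈ V, deriv (deriv p) z = 0) : ∃ α β : ℂ, ∀ z ∈ V, p z = α * z + β := by
  obtain ⟨α, hα⟩ := hV.exists_is_const_of_deriv_eq_zero hVc (hp.deriv hV) h
  have hd : DifferentiableOn ℂ (fun z => p z - α * z) V := by fun_prop
  obtain ⟨β, hβ⟩ := hV.exists_is_const_of_deriv_eq_zero hVc hd fun z hz => by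
    have h1 := (hp.differentiableAt (hV.mem_nhds hz)).hasDerivAt
    have h2 := (hasDerivAt_id z).const_mul α
    have h3 : deriv (fun z => p z - α * z) z = deriv p z - α * 1 := (h1.sub h2).deriv
    rw [h3, hα z hz, mul_one, sub_self, Pi.zero_apply]
  exact ⟨α, β, fun z hz => by rw [← hβ z hz]; ring⟩

/-- The columns of the matrix are orthogonal and have the same norm. -/
structure IsConformalMatrix (α β γ δ : ℂ) (K : ℝ) : Prop where
  pos : 0 < K
  left : α * conj α + γ * conj γ = K
  right : β * conj β + δ * conj δ = K
  orth : α * conj β + γ * conj δ = 0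

theorem exists_affine_of_norm_sq_add {p q : ℂ → ℂ} {V : Set ℂ} (hV : IsOpen V)
    (hVc : IsPreconnected V) (hVne : V.Nonempty)
    (hp : DifferentiableOn ℂ p V) (hq : DifferentiableOn ℂ q V)
    (h : ∀ z ∈ V, p z * conj (p z) + q z * conj (q z) = 1 + z * conj z) :
    ∃ α β γ δ : ℂ, IsConformalMatrix α β γ δ 1 ∧
      ∀ z ∈ V, p z = α * z + β ∧ q z = γ * z + δ := by
  -- One application gives |p'|² + |q'|² = 1; a second one, with k = 0, gives |p''|² + |q''|² = 0,
  -- so p and q are affine.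
  have h1 := deriv_mul_conj_of_norm_sq_add (c := 1) (k := 1) hV hp hq fun z hz => by
    rw [h z hz, one_mul]
  have h2 := deriv_mul_conj_of_norm_sq_add (c := 1) (k := 0) hV (hp.deriv hV) (hq.deriv hV)
    fun z hz => by rw [h1.2 z hz, zero_mul, add_zero]
  obtain ⟨α, β, hαβ⟩ := exists_affine_of_deriv_deriv_eq_zero hV hVc hp fun z hz =>
    (mul_conj_add_mul_conj_eq_zero (h2.2 z hz)).1
  obtain ⟨γ, δ, hγδ⟩ := exists_affine_of_deriv_deriv_eq_zero hV hVc hq fun z hz =>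
    (mul_conj_add_mul_conj_eq_zero (h2.2 z hz)).2
  refine ⟨α, β, γ, δ, ?_, fun z hz => ⟨hαβ z hz, hγδ z hz⟩⟩
  obtain ⟨z, hz⟩ := hVne
  have hder : ∀ {u : ℂ → ℂ} {a b : ℂ}, (∀ z ∈ V, u z = a * z + b) → deriv u z = a := by
    intro u a b hu
    have : u =ᶠ[𝓝 z] fun z => a * z + b := by
      filter_upwards [hV.mem_nhds hz] with w hw
      exact hu w hw
    rw [this.deriv_eq]
    simp
  have e0 := h z hz
  have e1 := h1.1 z hz
  have e2 := h1.2 z hz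
  rw [hder hαβ, hder hγδ] at e1 e2
  rw [hαβ z hz, hγδ z hz] at e0 e1
  simp only [map_add, map_mul] at e0 e1
  have e3 : α * conj β + γ * conj δ = 0 := by linear_combination e1 - conj z * e2
  have e4 : conj α * β + conj γ * δ = 0 := by simpa using congrArg conj e3
  refine ⟨one_pos, by simpa using e2, ?_, e3⟩
  push_cast
  linear_combination e0 - z * conj z * e2 - z * e3 - conj z * e4

theorem IsConformalMatrix.norm_sq_add {α β γ δ : ℂ} {K : ℝ} (h : IsConformalMatrix α β γ δ K)
    (z : ℂ) : (α * z + β) * conj (α * z + β) + (γ * z + δ) * conj (γ * z + δ)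
      = K * (1 + z * conj z) := by
  have e : conj α * β + conj γ * δ = 0 := by simpa using congrArg conj h.orth
  simp only [map_add, map_mul]
  linear_combination z * conj z * h.left + h.right + z * h.orth + conj z * e

theorem exists_eq_moebius_of_sph_eq {f : ℂ → ℂ} (hf : DifferentiableOn ℂ f (ball 0 1)) {r : ℝ}
    (hr : 0 < r) (hr1 : r < 1)
    (h : ∀ z : ℂ, r < ‖z‖ → ‖z‖ < 1 → sph f z = 1 / (1 + ‖z‖ ^ 2)) :
    ∃ α β γ δ : ℂ, IsConformalMatrix α β γ δ 1 ∧
      ∀ z ∈ ball (0 : ℂ) 1, f z * (γ * z + δ) = α * z + β := by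
  obtain ⟨t, hrt, ht1⟩ := exists_between hr1
  have ht0 : 0 < t := hr.trans hrt
  have hann : ∀ z : ℂ, r < ‖z‖ → ‖z‖ < 1 → deriv f z ≠ 0 := by
    intro z h1 h2 h0
    have := h z h1 h2
    rw [sph, h0, norm_zero, zero_div] at this
    have : (0 : ℝ) < 1 / (1 + ‖z‖ ^ 2) := by positivity
    linarith
  have hnt : ‖(t : ℂ)‖ = t := by simp [abs_of_pos ht0]
  have htmem : (t : ℂ) ∈ ball (0 : ℂ) 1 := by simpa [abs_of_pos ht0] using ht1
  set c := deriv f t with hc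
  have hc0 : c ≠ 0 := hann t (by rwa [hnt]) (by rwa [hnt])
  have hcd := continuousOn_deriv_ball hf
  have hev : ∀ᶠ z in 𝓝 (t : ℂ), (r < ‖z‖ ∧ ‖z‖ < 1) ∧ deriv f z / c ∈ slitPlane := by
    refine Filter.Eventually.and ?_ ?_
    · exact continuous_norm.continuousAt.eventually
        (Ioo_mem_nhds (hrt.trans_eq hnt.symm) (hnt.trans_lt ht1))
    · have : ContinuousAt (fun z => deriv f z / c) t :=
        (hcd.continuousAt (isOpen_ball.mem_nhds htmem)).div_const c
      refine this.eventually (isOpen_slitPlane.mem_nhds ?_)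
      simp only [← hc, div_self hc0]
      exact one_mem_slitPlane
  obtain ⟨ε, hε, hball⟩ := Metric.eventually_nhds_iff_ball.1 hev
  set V := ball (t : ℂ) ε with hVdef
  have hV1 : V ⊆ ball 0 1 := fun z hz => by simpa using (hball z hz).1.2
  -- A branch g of √f' near t: dividing by c = f'(t) brings the values near 1, inside the domain of
  -- the principal logarithm, and s² = c restores the factor.
  obtain ⟨s, hs⟩ := IsAlgClosed.exists_pow_nat_eq c (n := 2) two_pos
  have hs0 : s ≠ 0 := by
    rintro rfl
    exact hc0 (by simpa using hs.symm)
  set g : ℂ → ℂ := fun z => s * exp (log (deriv f z / c) / 2) with hg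
  have hg0 : ∀ z, g z ≠ 0 := fun z => mul_ne_zero hs0 (exp_ne_zero _)
  have hg2 : ∀ z ∈ V, g z ^ 2 = deriv f z := by
    intro z hz
    have hne : deriv f z / c ≠ 0 := slitPlane_ne_zero (hball z hz).2
    rw [hg]
    simp only
    rw [mul_pow, hs, ← exp_nat_mul, Nat.cast_ofNat, mul_div_cancel₀ _ two_ne_zero, exp_log hne,
      mul_div_cancel₀ _ hc0]
  have hgd : DifferentiableOn ℂ g V := by
    have h1 : DifferentiableOn ℂ (fun z => deriv f z / c) V :=
      ((hf.deriv isOpen_ball).mono hV1).div_const c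
    exact (((h1.clog fun z hz => (hball z hz).2).div_const 2).cexp).const_mul s
  obtain ⟨α, β, γ, δ, hM, hpq⟩ := exists_affine_of_norm_sq_add (p := fun z => f z / g z)
    (q := fun z => 1 / g z) isOpen_ball (convex_ball (t : ℂ) ε).isPreconnected
    ⟨t, mem_ball_self hε⟩ ((hf.mono hV1).div hgd fun z _ => hg0 z)
    ((differentiableOn_const 1).div hgd fun z _ => hg0 z) (fun z hz => by
      have h1 := h z (hball z hz).1.1 (hball z hz).1.2
      have h2 : ‖g z‖ ^ 2 = ‖deriv f z‖ := by rw [← norm_pow, hg2 z hz]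
      have h3 : ‖g z‖ ≠ 0 := norm_ne_zero_iff.2 (hg0 z)
      rw [sph, div_eq_div_iff (by positivity) (by positivity), ← h2] at h1
      have h4 : ‖f z / g z‖ ^ 2 + ‖1 / g z‖ ^ 2 = 1 + ‖z‖ ^ 2 := by
        rw [norm_div, norm_div, norm_one]
        field_simp
        linarith
      rw [mul_conj, mul_conj, mul_conj]
      simp only [normSq_eq_norm_sq]
      exact_mod_cast h4)
  refine ⟨α, β, γ, δ, hM, ?_⟩
  -- The identity theorem carries the relation from V to the disk; the form without denominators
  -- avoids discussing zeros of γz + δ.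
  have hfa : AnalyticOnNhd ℂ (fun z => f z * (γ * z + δ)) (ball 0 1) := by
    refine DifferentiableOn.analyticOnNhd ?_ isOpen_ball
    fun_prop
  have hga : AnalyticOnNhd ℂ (fun z => α * z + β) (ball 0 1) := by
    refine DifferentiableOn.analyticOnNhd ?_ isOpen_ball
    fun_prop
  refine hfa.eqOn_of_preconnected_of_eventuallyEq hga (convex_ball (0 : ℂ) 1).isPreconnected htmem ?_
  filter_upwards [isOpen_ball.mem_nhds (mem_ball_self hε)] with z hz
  rw [← (hpq z hz).1, ← (hpq z hz).2]
  ring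

/-! ### Conformal matrices and rotations of the sphere. -/

theorem sphereDiv_mul_left {k : ℂ} (hk : k ≠ 0) (p q : ℂ) :
    sphereDiv (k * p) (k * q) = sphereDiv p q := by
  unfold sphereDiv
  by_cases hq : q = 0
  · simp [hq]
  · simp [hq, hk, mul_div_mul_left]

theorem exists_exp_mul_I_eq {e : ℂ} (he : ‖e‖ = 1) : ∃ θ : ℝ, exp (θ * I) = e :=
  ⟨arg e, by simpa [he] using norm_mul_exp_arg_mul_I e⟩

/-- Such a matrix is √K times a unitary one. If α = 0, orthogonality gives δ = 0 and the map is
e^{iθ}/z. Otherwise |α| = |δ|, and dividing by δ gives the normal form with a = -β/α and e^{iθ} =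
α/δ. -/
theorem IsConformalMatrix.exists_sphereRotation {α β γ δ : ℂ} {K : ℝ}
    (h : IsConformalMatrix α β γ δ K) :
    ∃ T ∈ sphereRotations, ∀ z : ℂ, T z = sphereDiv (α * z + β) (γ * z + δ) := by
  have hK : (K : ℂ) ≠ 0 := by exact_mod_cast h.pos.ne'
  have horth : conj α * β + conj γ * δ = 0 := by simpa using congrArg conj h.orth
  have hnorm : ∀ {x y : ℂ}, x * conj x = y * conj y → ‖x‖ = ‖y‖ := by
    intro x y hxy
    rw [mul_conj, mul_conj, normSq_eq_norm_sq, normSq_eq_norm_sq] at hxy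
    have : ‖x‖ ^ 2 = ‖y‖ ^ 2 := by exact_mod_cast hxy
    exact (sq_eq_sq₀ (norm_nonneg _) (norm_nonneg _)).1 this
  by_cases hα : α = 0
  · have hl := h.left
    have hr := h.right
    subst hα
    have hγ : γ ≠ 0 := by
      rintro rfl
      simp at hl
      exact hK hl.symm
    have hδ : δ = 0 := by simpa [hγ] using horth
    subst hδ
    simp only [map_zero, mul_zero, zero_add, add_zero] at hl hr
    have he : ‖β / γ‖ = 1 := by
      rw [norm_div, hnorm (hr.trans hl.symm), div_self (norm_ne_zero_iff.2 hγ)]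
    obtain ⟨θ, hθ⟩ := exists_exp_mul_I_eq he
    refine ⟨sphereRotationInv θ, Or.inr ⟨θ, rfl⟩, fun z => ?_⟩
    change sphereDiv (exp (θ * I)) z = _
    rw [hθ, ← sphereDiv_mul_left hγ, mul_div_cancel₀ _ hγ]
    simp
  · have hα' : conj α ≠ 0 := (map_ne_zero _).2 hα
    have hβ : β = -(conj γ * δ) / conj α := by
      rw [eq_div_iff hα']
      linear_combination horth
    have hδα : δ * conj δ = α * conj α := by
      have hr := h.right
      rw [hβ] at hr
      simp only [map_div₀, map_neg, map_mul, conj_conj] at hr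
      have : δ * conj δ * K = α * conj α * K := by
        rw [← h.left] at hr ⊢
        field_simp at hr
        linear_combination hr
      exact mul_right_cancel₀ hK this
    have hδ : δ ≠ 0 := by
      rintro rfl
      simp [hα] at hδα
    have he : ‖α / δ‖ = 1 := by
      rw [norm_div, hnorm hδα, div_self (norm_ne_zero_iff.2 hα)]
    obtain ⟨θ, hθ⟩ := exists_exp_mul_I_eq he
    refine ⟨sphereRotation θ (-β / α), Or.inl ⟨θ, _, rfl⟩, fun z => ?_⟩
    change sphereDiv (exp (θ * I) * (z - -β / α)) (1 + z * conj (-β / α)) = _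
    rw [hθ, ← sphereDiv_mul_left hδ]
    congr 1
    · field_simp
      ring
    · simp only [map_div₀, map_neg]
      have : δ * conj β = -(γ * conj α) := by
        apply mul_left_cancel₀ hα
        linear_combination δ * h.orth - γ * hδα
      field_simp
      linear_combination (-z) * this

/-! ### Stereographic projection and antipodal pairs in convex domains. -/

theorem toSphere_coe (z : ℂ) : toSphere (z : OnePoint ℂ)
    = (((2 / (1 + ‖z‖ ^ 2) : ℝ) : ℂ) * z, (‖z‖ ^ 2 - 1) / (‖z‖ ^ 2 + 1)) := rfl

theorem toSphere_infty : toSphere ∞ = ((0, 1) : ℂ × ℝ) := rfl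

theorem norm_sq_toSphere (p : OnePoint ℂ) : ‖(toSphere p).1‖ ^ 2 + (toSphere p).2 ^ 2 = 1 := by
  induction p using OnePoint.rec with
  | infty => simp [toSphere_infty]
  | coe z =>
    rw [toSphere_coe, norm_mul, norm_real, Real.norm_of_nonneg (by positivity)]
    simp only
    field_simp
    ring

theorem toSphere_coe_snd_lt_one (z : ℂ) : (toSphere (z : OnePoint ℂ)).2 < 1 := by
  rw [toSphere_coe]
  simp only
  rw [div_lt_one (by positivity)]
  linarith

theorem toSphere_fst_div (z : ℂ) :
    (toSphere (z : OnePoint ℂ)).1 / ((1 - (toSphere (z : OnePoint ℂ)).2 : ℝ) : ℂ) = z := by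
  rw [toSphere_coe]
  simp only
  have h1 : (1 - (‖z‖ ^ 2 - 1) / (‖z‖ ^ 2 + 1) : ℝ) = 2 / (1 + ‖z‖ ^ 2) := by
    field_simp
    ring
  have h2 : ((2 / (1 + ‖z‖ ^ 2) : ℝ) : ℂ) ≠ 0 := by
    rw [Ne, ofReal_eq_zero]
    positivity
  rw [h1, mul_div_cancel_left₀ _ h2]

theorem toSphere_injective : Function.Injective toSphere := by
  intro p q h
  induction p using OnePoint.rec with
  | infty =>
    induction q using OnePoint.rec with
    | infty => rfl
    | coe w =>
      have := toSphere_coe_snd_lt_one w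
      rw [← h, toSphere_infty] at this
      exact absurd this (lt_irrefl _)
  | coe z =>
    induction q using OnePoint.rec with
    | infty =>
      have := toSphere_coe_snd_lt_one z
      rw [h, toSphere_infty] at this
      exact absurd this (lt_irrefl _)
    | coe w => rw [← toSphere_fst_div z, h, toSphere_fst_div w]

/-- Stereographic projection of the radial projection of a vector to the unit sphere. -/
theorem toSphere_stereographic {w : ℂ} {t n : ℝ} (hn : 0 < n) (hnt : t < n)
    (h : ‖w‖ ^ 2 + t ^ 2 = n ^ 2) :
    toSphere ((w / ((n - t : ℝ) : ℂ) : ℂ) : OnePoint ℂ) = n⁻¹ • (w, t) := by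
  have hd : 0 < n - t := sub_pos.2 hnt
  have hz : ‖w / ((n - t : ℝ) : ℂ)‖ ^ 2 = (n + t) / (n - t) := by
    rw [norm_div, norm_real, Real.norm_of_nonneg hd.le, div_pow, div_eq_div_iff (by positivity) hd.ne']
    linear_combination (n - t) * h
  rw [toSphere_coe, hz]
  have h1 : 2 / (1 + (n + t) / (n - t)) = (n - t) / n := by
    have : 1 + (n + t) / (n - t) = 2 * n / (n - t) := by field_simp; ring
    rw [this]
    field_simp
  have h2 : ((n + t) / (n - t) - 1) / ((n + t) / (n - t) + 1) = t / n := by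
    have e1 : (n + t) / (n - t) + 1 = 2 * n / (n - t) := by field_simp; ring
    have e2 : (n + t) / (n - t) - 1 = 2 * t / (n - t) := by field_simp; ring
    rw [e1, e2]
    field_simp
  rw [h1, h2, Prod.smul_mk]
  refine Prod.ext ?_ ?_
  · simp only [real_smul]
    have h3 : ((n - t : ℝ) : ℂ) ≠ 0 := by exact_mod_cast hd.ne'
    have h4 : (n : ℂ) ≠ 0 := by exact_mod_cast hn.ne'
    rw [ofReal_div, ofReal_inv]
    field_simp
  · simp [div_eq_inv_mul]

theorem IsAntipodal.symm {a b : OnePoint ℂ} (h : IsAntipodal a b) : IsAntipodal b a := by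
  rw [IsAntipodal] at h ⊢
  rw [h, neg_neg]

/-- A spherically convex domain that contains a pair of antipodal points is the whole sphere. -/
theorem eq_univ_of_isAntipodal {Ω : Set (OnePoint ℂ)} (hΩ : IsSphericallyConvexDomain Ω)
    {a b : OnePoint ℂ} (ha : a ∈ Ω) (hb : b ∈ Ω) (hab : IsAntipodal a b) : Ω = univ := by
  -- The roles of a and b are symmetric, and ∞ is not its own antipode.
  wlog hfin : b ≠ ∞ generalizing a b
  · refine this hb ha hab.symm ?_
    rintro rfl
    rw [not_ne_iff.1 hfin, IsAntipodal, toSphere_infty] at hab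
    have := congrArg Prod.snd hab
    norm_num at this
  obtain ⟨z, rfl⟩ := OnePoint.ne_infty_iff_exists.1 hfin
  refine eq_univ_of_forall fun c => ?_
  by_cases hca : c = a
  · rwa [hca]
  by_cases hcb : c = z
  · rwa [hcb]
  set B := toSphere (z : OnePoint ℂ) with hB
  set C := toSphere c with hC
  have hA : toSphere a = -B := by
    rw [hB, hab, neg_neg]
  -- Move from b slightly towards c: (B + εC)/n(ε) is a point of the sphere, with stereographic
  -- coordinate β(ε), and lies in the open set Ω for small ε > 0.
  set n : ℝ → ℝ := fun ε => √(‖B.1 + ε * C.1‖ ^ 2 + (B.2 + ε * C.2) ^ 2) with hn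
  have hnc : Continuous n := by fun_prop
  have hn0 : n 0 = 1 := by
    simp only [hn, ofReal_zero, zero_mul, add_zero]
    rw [norm_sq_toSphere, Real.sqrt_one]
  have hB2 : B.2 < 1 := toSphere_coe_snd_lt_one z
  set β : ℝ → ℂ := fun ε => (B.1 + ε * C.1) / ((n ε - (B.2 + ε * C.2) : ℝ) : ℂ) with hβ
  have hβ0 : β 0 = z := by
    simp only [hβ, hn0, ofReal_zero, zero_mul, add_zero]
    exact toSphere_fst_div z
  have hβc : ContinuousAt β 0 := by
    refine ContinuousAt.div (by fun_prop) (by fun_prop) ?_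
    rw [Ne, ofReal_eq_zero, hn0]
    simp only [zero_mul, add_zero]
    linarith
  have hev : ∀ᶠ ε in 𝓝 (0 : ℝ), ((β ε : OnePoint ℂ) ∈ Ω ∧ 0 < n ε) ∧ B.2 + ε * C.2 < n ε := by
    refine (Eventually.and ?_ ?_).and ?_
    · have h1 : ContinuousAt (fun ε => (β ε : OnePoint ℂ)) 0 :=
        OnePoint.continuous_coe.continuousAt.comp hβc
      exact h1.eventually (hΩ.1.mem_nhds (by simpa only [hβ0] using hb))
    · exact hnc.continuousAt.eventually (lt_mem_nhds (by rw [hn0]; exact one_pos))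
    · refine ContinuousAt.eventually_lt (by fun_prop) hnc.continuousAt ?_
      rw [hn0]
      simpa using hB2
  obtain ⟨ε, hε, hε0⟩ := ((hev.filter_mono nhdsWithin_le_nhds).and
    (self_mem_nhdsWithin (a := (0 : ℝ)) (s := Ioi 0))).exists
  obtain ⟨⟨hmem, hnpos⟩, hlt⟩ := hε
  have hP : toSphere (β ε : OnePoint ℂ) = (n ε)⁻¹ • (B.1 + ε * C.1, B.2 + ε * C.2) := by
    refine toSphere_stereographic hnpos hlt ?_
    rw [hn, Real.sq_sqrt (by positivity)]
  have hvec : ((B.1 + ε * C.1, B.2 + ε * C.2) : ℂ × ℝ) = B + ε • C := by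
    ext <;> simp
  rw [hvec] at hP
  have hVn : n ε • toSphere (β ε : OnePoint ℂ) = B + ε • C := by
    rw [hP, smul_inv_smul₀ hnpos.ne']
  -- Since A = -B, C = ε⁻¹A + ε⁻¹n(ε)P for the new point P, so c lies on the arc from a to P. If a
  -- and P were antipodal, C would be ±B, which is excluded.
  refine hΩ.2.2 a ha (β ε) hmem (fun hanti => ?_) ⟨ε⁻¹, ε⁻¹ * n ε, by positivity, by positivity, ?_⟩
  · rw [IsAntipodal, hA, neg_neg] at hanti
    rw [hanti] at hVn
    have hCk : C = (ε⁻¹ * (n ε - 1)) • B := by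
      rw [mul_smul, sub_smul, one_smul, hVn, add_sub_cancel_left, inv_smul_smul₀ hε0.ne']
    set k := ε⁻¹ * (n ε - 1)
    have h1 := norm_sq_toSphere c
    have h2 := norm_sq_toSphere (z : OnePoint ℂ)
    rw [← hC, hCk] at h1
    rw [← hB] at h2
    simp only [Prod.smul_fst, Prod.smul_snd, norm_smul, smul_eq_mul, Real.norm_eq_abs, mul_pow,
      sq_abs] at h1
    rw [← mul_add, h2, mul_one] at h1
    rcases sq_eq_one_iff.1 h1 with hk | hk
    · exact hcb (toSphere_injective (by rw [← hC, hCk, hk, one_smul]))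
    · exact hca (toSphere_injective (by rw [← hC, hCk, hk, neg_one_smul, hA]))
  · rw [mul_smul, hVn, hA, ← hC, ← smul_add, neg_add_cancel_left, inv_smul_smul₀ hε0.ne']

/-! ### Homogeneous coordinates and charts. -/

/-- The numerator homogeneous coordinate on the Riemann sphere. -/
def homNum (p : OnePoint ℂ) : ℂ := p.elim (1 : ℂ) (fun z : ℂ => z)

/-- The denominator homogeneous coordinate on the Riemann sphere. -/
def homDen (p : OnePoint ℂ) : ℂ := p.elim (0 : ℂ) (fun _ : ℂ => 1)

theorem isAntipodal_of_homNum {a b : OnePoint ℂ}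
    (h : homNum a * conj (homNum b) + homDen a * conj (homDen b) = 0) : IsAntipodal a b := by
  have hzero : toSphere ((0 : ℂ) : OnePoint ℂ) = (0, -1) := by
    rw [toSphere_coe]
    simp
  induction a using OnePoint.rec with
  | infty =>
    induction b using OnePoint.rec with
    | infty => simp [homNum, homDen] at h
    | coe w =>
      have hw : w = 0 := by simpa [homNum, homDen] using h
      rw [IsAntipodal, hw, hzero, toSphere_infty]
      simp
  | coe z =>
    induction b using OnePoint.rec with
    | infty =>
      have hz : z = 0 := by simpa [homNum, homDen] using h
      rw [IsAntipodal, hz, hzero, toSphere_infty]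
      simp
    | coe w =>
      have h' : z * conj w + 1 = 0 := by simpa [homNum, homDen] using h
      have hw : w ≠ 0 := by
        rintro rfl
        simp at h'
      have hz : z = -(conj w)⁻¹ := by
        have : conj w ≠ 0 := (map_ne_zero _).2 hw
        field_simp
        linear_combination h'
      have hnw : ‖w‖ ≠ 0 := norm_ne_zero_iff.2 hw
      rw [IsAntipodal, toSphere_coe, toSphere_coe]
      have hnz : ‖z‖ = ‖w‖⁻¹ := by rw [hz, norm_neg, norm_inv, RCLike.norm_conj]
      refine Prod.ext ?_ ?_
      · simp only [Prod.fst_neg]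
        rw [hnz, hz]
        have e : (2 / (1 + ‖w‖⁻¹ ^ 2) : ℝ) = 2 / (1 + ‖w‖ ^ 2) * ‖w‖ ^ 2 := by
          field_simp
          ring
        have e2 : ((‖w‖ ^ 2 : ℝ) : ℂ) * (conj w)⁻¹ = w := by
          rw [← normSq_eq_norm_sq, ← mul_conj]
          have : conj w ≠ 0 := (map_ne_zero _).2 hw
          field_simp
        rw [e, ofReal_mul]
        linear_combination (-((2 / (1 + ‖w‖ ^ 2) : ℝ) : ℂ)) * e2
      · simp only [Prod.snd_neg]
        rw [hnz]
        field_simp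
        ring

theorem sphereDiv_homNum_homDen (p : OnePoint ℂ) : sphereDiv (homNum p) (homDen p) = p := by
  induction p using OnePoint.rec with
  | infty => simp [sphereDiv, homDen]
  | coe z => simp [sphereDiv, homNum, homDen]

theorem chart_coe (z : ℂ) : chart (z : OnePoint ℂ) = z := rfl

theorem chartInv_coe (z : ℂ) : chartInv (z : OnePoint ℂ) = z⁻¹ := rfl

theorem chartInv_infty : chartInv ∞ = 0 := rfl

theorem coe_chart {p : OnePoint ℂ} (h : p ≠ ∞) : (chart p : OnePoint ℂ) = p := by
  obtain ⟨z, rfl⟩ := OnePoint.ne_infty_iff_exists.1 h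
  rfl

theorem sphereDiv_one_chartInv {p : OnePoint ℂ} (h : p ≠ ((0 : ℂ) : OnePoint ℂ)) :
    sphereDiv 1 (chartInv p) = p := by
  induction p using OnePoint.rec with
  | infty => simp [sphereDiv, chartInv_infty]
  | coe z =>
    have : z ≠ 0 := fun h0 => h (by rw [h0])
    simp [sphereDiv, chartInv_coe, this]

/-! ### Injective meromorphic maps are open; the disk does not cover the sphere. -/

section

variable {F : ℂ → OnePoint ℂ}

theorem eventually_ne_of_ne (hF : IsMeromorphicMapOn F (ball 0 1)) {z : ℂ}
    (hz : z ∈ ball (0 : ℂ) 1) {p : OnePoint ℂ} (h : F z ≠ p) :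
    ∀ᶠ w in 𝓝 z, w ∈ ball (0 : ℂ) 1 ∧ F w ≠ p :=
  Filter.Eventually.and (isOpen_ball.mem_nhds hz) <|
    (hF.1.continuousAt (isOpen_ball.mem_nhds hz)).eventually (isOpen_compl_singleton.mem_nhds h)

theorem analyticAt_chart (hF : IsMeromorphicMapOn F (ball 0 1)) {z : ℂ}
    (hz : z ∈ ball (0 : ℂ) 1) (h : F z ≠ ∞) : AnalyticAt ℂ (fun w => chart (F w)) z := by
  rw [Complex.analyticAt_iff_eventually_differentiableAt]
  filter_upwards [eventually_ne_of_ne hF hz h] with w hw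
  exact (hF.2 w hw.1).1 hw.2

theorem analyticAt_chartInv (hF : IsMeromorphicMapOn F (ball 0 1)) {z : ℂ}
    (hz : z ∈ ball (0 : ℂ) 1) (h : F z ≠ ((0 : ℂ) : OnePoint ℂ)) :
    AnalyticAt ℂ (fun w => chartInv (F w)) z := by
  rw [Complex.analyticAt_iff_eventually_differentiableAt]
  filter_upwards [eventually_ne_of_ne hF hz h] with w hw
  exact (hF.2 w hw.1).2 hw.2

theorem nhds_infty_le_map_sphereDiv : 𝓝 (∞ : OnePoint ℂ) ≤ map (sphereDiv 1) (𝓝 0) := by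
  intro S hS
  obtain ⟨ε, hε, hball⟩ := Metric.mem_nhds_iff.1 (mem_map.1 hS)
  rw [OnePoint.nhds_infty_eq, mem_sup]
  constructor
  · rw [mem_map, coclosedCompact_eq_cocompact, mem_cocompact]
    refine ⟨closedBall 0 (2 / ε), isCompact_closedBall _ _, fun z hz => ?_⟩
    have hz' : 2 / ε < ‖z‖ := by simpa using hz
    have hz0 : 0 < ‖z‖ := lt_trans (by positivity) hz'
    have hmem : z⁻¹ ∈ ball (0 : ℂ) ε := by
      rw [mem_ball_zero_iff, norm_inv, inv_lt_comm₀ hz0 hε]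
      refine lt_trans ?_ hz'
      rw [inv_eq_one_div]
      gcongr
      norm_num
    have := hball hmem
    simpa [sphereDiv, norm_pos_iff.1 hz0] using this
  · rw [mem_pure]
    have := hball (mem_ball_self hε)
    simpa [sphereDiv] using this

theorem nhds_le_map_of_injOn (hF : IsMeromorphicMapOn F (ball 0 1)) (hinj : InjOn F (ball 0 1))
    {z : ℂ} (hz : z ∈ ball (0 : ℂ) 1) : 𝓝 (F z) ≤ map F (𝓝 z) := by
  -- If the local coordinate u were constant near z, F would be too, contradicting injectivity. The
  -- open mapping alternative then leaves only openness.
  have hnc : ∀ {u : ℂ → ℂ} {G : ℂ → OnePoint ℂ}, (∀ᶠ w in 𝓝 z, F w = G (u w)) →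
      ¬∀ᶠ w in 𝓝 z, u w = u z := by
    intro u G hG hu
    have h1 : ∀ᶠ w in 𝓝 z, w = z := by
      filter_upwards [hG, hu, isOpen_ball.mem_nhds hz] with w h1 h2 h3
      refine hinj h3 hz ?_
      rw [h1, h2, hG.self_of_nhds]
    have h2 : ∀ᶠ w in 𝓝[≠] z, w = z := h1.filter_mono nhdsWithin_le_nhds
    obtain ⟨w, hw, hw'⟩ := (h2.and self_mem_nhdsWithin).exists
    exact hw' hw
  by_cases h : F z = ∞
  · have h0 : F z ≠ ((0 : ℂ) : OnePoint ℂ) := by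
      rw [h]
      exact OnePoint.infty_ne_coe 0
    have hG : ∀ᶠ w in 𝓝 z, F w = sphereDiv 1 (chartInv (F w)) := by
      filter_upwards [eventually_ne_of_ne hF hz h0] with w hw
      rw [sphereDiv_one_chartInv hw.2]
    have h1 := (analyticAt_chartInv hF hz h0).eventually_constant_or_nhds_le_map_nhds.resolve_left
      (hnc hG)
    rw [h, chartInv_infty] at h1
    rw [h, map_congr hG]
    exact nhds_infty_le_map_sphereDiv.trans (map_mono h1)
  · have hG : ∀ᶠ w in 𝓝 z, F w = ((chart (F w) : ℂ) : OnePoint ℂ) := by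
      filter_upwards [eventually_ne_of_ne hF hz h] with w hw
      rw [coe_chart hw.2]
    have h1 := (analyticAt_chart hF hz h).eventually_constant_or_nhds_le_map_nhds.resolve_left
      (hnc (G := fun v => (v : OnePoint ℂ)) hG)
    rw [map_congr hG]
    calc 𝓝 (F z) = map (fun v : ℂ => (v : OnePoint ℂ)) (𝓝 (chart (F z))) := by
          rw [← OnePoint.nhds_coe_eq, coe_chart h]
      _ ≤ _ := map_mono h1

theorem isOpen_image_of_injOn (hF : IsMeromorphicMapOn F (ball 0 1)) (hinj : InjOn F (ball 0 1))
    {W : Set ℂ} (hW : IsOpen W) (hsub : W ⊆ ball 0 1) : IsOpen (F '' W) := by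
  rw [isOpen_iff_mem_nhds]
  rintro _ ⟨z, hz, rfl⟩
  exact nhds_le_map_of_injOn hF hinj (hsub hz) (image_mem_map (hW.mem_nhds hz))

/-- The disk is not conformally equivalent to the sphere. -/
theorem image_ball_ne_univ (hF : IsMeromorphicMapOn F (ball 0 1)) (hinj : InjOn F (ball 0 1)) :
    F '' ball 0 1 ≠ univ := by
  intro h
  have hsub : ∀ r : Iio (1 : ℝ), ball (0 : ℂ) r ⊆ ball 0 1 := fun r => ball_subset_ball r.2.le
  have : Nonempty (Iio (1 : ℝ)) := ⟨⟨0, mem_Iio.2 one_pos⟩⟩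
  -- The open sets F(rD), r < 1, exhaust the sphere, so by compactness a single one is the whole
  -- sphere; a point of modulus t in (r, 1) then shares its value with a point of rD.
  obtain ⟨r, hr⟩ := isCompact_univ.elim_directed_cover
    (fun r : Iio (1 : ℝ) => F '' ball 0 r)
    (fun r => isOpen_image_of_injOn hF hinj isOpen_ball (hsub r))
    (by
      rw [← h]
      rintro _ ⟨z, hz, rfl⟩
      obtain ⟨r, hr, hr1⟩ := exists_between (mem_ball_zero_iff.1 hz)
      exact mem_iUnion.2 ⟨⟨r, hr1⟩, z, by simpa using hr, rfl⟩)
    (directed_of_isDirected_le fun r s hrs => image_mono (ball_subset_ball hrs))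
  obtain ⟨t, hrt, ht1⟩ := exists_between (max_lt (mem_Iio.1 r.2) one_pos)
  have ht0 : 0 < t := (le_max_right _ _).trans_lt hrt
  have ht : (t : ℂ) ∈ ball (0 : ℂ) 1 := by simpa [abs_of_pos ht0] using ht1
  obtain ⟨w, hw, hwt⟩ := hr (mem_univ (F t))
  have := hinj (hsub r hw) ht hwt
  subst this
  rw [mem_ball_zero_iff, norm_real, Real.norm_of_nonneg ht0.le] at hw
  exact absurd ((le_max_left _ _).trans_lt hrt) hw.not_gt

theorem not_isAntipodal (hF : IsSphericallyConvexMap F) {z w : ℂ} (hz : z ∈ ball (0 : ℂ) 1)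
    (hw : w ∈ ball (0 : ℂ) 1) : ¬IsAntipodal (F z) (F w) := fun h =>
  image_ball_ne_univ hF.1 hF.2.1
    (eq_univ_of_isAntipodal hF.2.2 (mem_image_of_mem F hz) (mem_image_of_mem F hw) h)

end

/-! ### Rotating the target to get a holomorphic model. -/

theorem IsConformalMatrix.swap {α β γ δ : ℂ} {K : ℝ} (h : IsConformalMatrix α β γ δ K) :
    IsConformalMatrix γ δ α β K :=
  ⟨h.pos, by rw [add_comm, h.left], by rw [add_comm, h.right], by rw [add_comm, h.orth]⟩

theorem IsConformalMatrix.norm_det {α β γ δ : ℂ} {K : ℝ} (h : IsConformalMatrix α β γ δ K) :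
    ‖α * δ - β * γ‖ = K := by
  have e : conj α * β + conj γ * δ = 0 := by simpa using congrArg conj h.orth
  have h1 : (α * δ - β * γ) * conj (α * δ - β * γ) = (K : ℂ) ^ 2 := by
    simp only [map_sub, map_mul]
    linear_combination (β * conj β + δ * conj δ) * h.left + K * h.right
      - (conj α * β + conj γ * δ) * h.orth
  rw [mul_conj, normSq_eq_norm_sq] at h1
  have h2 : ‖α * δ - β * γ‖ ^ 2 = K ^ 2 := by exact_mod_cast h1
  exact (sq_eq_sq₀ (norm_nonneg _) h.pos.le).1 h2

/-- Rotations of the sphere preserve the spherical derivative. -/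
theorem IsConformalMatrix.sph_eq {α β γ δ : ℂ} {K : ℝ} (h : IsConformalMatrix α β γ δ K)
    {u f : ℂ → ℂ} {z : ℂ} (hu : DifferentiableAt ℂ u z) (hne : γ * u z + δ ≠ 0)
    (hf : ∀ᶠ w in 𝓝 z, f w = (α * u w + β) / (γ * u w + δ)) : sph f z = sph u z := by
  have h1 := hu.hasDerivAt
  have h2 := (((h1.const_mul α).add_const β).div
    ((h1.const_mul γ).add_const δ) hne).congr_of_eventuallyEq hf
  have h3 : deriv f z = deriv u z * (α * δ - β * γ) / (γ * u z + δ) ^ 2 := by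
    rw [h2.deriv]
    congr 1
    ring
  have h4 : ‖α * u z + β‖ ^ 2 + ‖γ * u z + δ‖ ^ 2 = K * (1 + ‖u z‖ ^ 2) := by
    have := h.norm_sq_add (u z)
    simp only [mul_conj, normSq_eq_norm_sq] at this
    exact_mod_cast this
  have hn : ‖γ * u z + δ‖ ≠ 0 := norm_ne_zero_iff.2 hne
  have hK := h.pos
  have h5 : 1 + ‖f z‖ ^ 2 = K * (1 + ‖u z‖ ^ 2) / ‖γ * u z + δ‖ ^ 2 := by
    rw [hf.self_of_nhds, norm_div, div_pow, ← h4, add_div, div_self (pow_ne_zero 2 hn), add_comm]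
  rw [sph, sph, h3, h5, norm_div, norm_mul, h.norm_det, norm_pow]
  field_simp

theorem sphericalDeriv_eq_sph_chart {F : ℂ → OnePoint ℂ} {z : ℂ} (h : F z ≠ ∞) :
    sphericalDeriv F z = sph (fun w => chart (F w)) z := by
  rw [sphericalDeriv, if_neg h]
  rfl

theorem sphericalDeriv_eq_sph_chartInv {F : ℂ → OnePoint ℂ} {z : ℂ} (h : F z = ∞) :
    sphericalDeriv F z = sph (fun w => chartInv (F w)) z := by
  rw [sphericalDeriv, if_pos h]
  rfl

/-- The rotation of the sphere that maps `a` to `0`, in affine coordinates on the target. -/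
noncomputable def rotateToZero (a : ℂ) (p : OnePoint ℂ) : ℂ :=
  (homNum p - a * homDen p) / (homDen p + conj a * homNum p)

theorem homDen_add_ne_zero {a : ℂ} {p : OnePoint ℂ} (h : ¬IsAntipodal a p) :
    homDen p + conj a * homNum p ≠ 0 := by
  intro h0
  refine h (isAntipodal_of_homNum ?_)
  have : conj (homDen p + conj a * homNum p) = 0 := by rw [h0, map_zero]
  simp only [map_add, map_mul, conj_conj] at this
  rw [show homNum (a : OnePoint ℂ) = a from rfl, show homDen (a : OnePoint ℂ) = 1 from rfl]
  linear_combination this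

theorem isConformalMatrix_rotateToZero (a : ℂ) :
    IsConformalMatrix 1 (-a) (conj a) 1 (1 + ‖a‖ ^ 2) := by
  have h := one_add_mul_conj a
  refine ⟨by positivity, ?_, ?_, ?_⟩
  · rw [← h]
    simp only [map_one, conj_conj]
    ring
  · rw [← h]
    simp only [map_one, map_neg]
    ring
  · simp

theorem isConformalMatrix_rotateToZero_inv (a : ℂ) :
    IsConformalMatrix (-a) 1 1 (conj a) (1 + ‖a‖ ^ 2) := by
  have h := one_add_mul_conj a
  refine ⟨by positivity, ?_, ?_, ?_⟩
  · rw [← h]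
    simp only [map_one, map_neg]
    ring
  · rw [← h]
    simp only [map_one, conj_conj]
    ring
  · simp

theorem rotateToZero_of_ne_infty {a : ℂ} {p : OnePoint ℂ} (h : p ≠ ∞) :
    rotateToZero a p = (1 * chart p + -a) / (conj a * chart p + 1) := by
  obtain ⟨z, rfl⟩ := OnePoint.ne_infty_iff_exists.1 h
  simp only [rotateToZero, homNum, homDen, chart_coe, OnePoint.elim_some]
  congr 1 <;> ring

theorem rotateToZero_of_ne_zero {a : ℂ} {p : OnePoint ℂ} (h : p ≠ ((0 : ℂ) : OnePoint ℂ)) :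
    rotateToZero a p = (-a * chartInv p + 1) / (1 * chartInv p + conj a) := by
  induction p using OnePoint.rec with
  | infty => simp [rotateToZero, homNum, homDen, chartInv_infty]
  | coe z =>
    have hz : z ≠ 0 := fun h0 => h (by rw [h0])
    simp only [rotateToZero, homNum, homDen, chartInv_coe, OnePoint.elim_some]
    rw [← mul_div_mul_left (-a * z⁻¹ + 1) _ hz]
    congr 1 <;> field_simp
    ring

/-- Rotations preserve the Hermitian product up to scale: the numerator is 1 + |a|² times the
product of the homogeneous coordinates of p and q, which vanishes only for antipodal points. -/
theorem one_add_rotateToZero_mul_conj_ne_zero {a : ℂ} {p q : OnePoint ℂ}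
    (hp : ¬IsAntipodal a p) (hq : ¬IsAntipodal a q) (hpq : ¬IsAntipodal p q) :
    1 + rotateToZero a p * conj (rotateToZero a q) ≠ 0 := by
  have h1 := homDen_add_ne_zero hp
  have h2 := homDen_add_ne_zero hq
  have h2' : conj (homDen q) + a * conj (homNum q) ≠ 0 := by
    have := (map_ne_zero (starRingEnd ℂ)).2 h2
    simpa using this
  intro h
  refine hpq (isAntipodal_of_homNum ?_)
  simp only [rotateToZero, map_div₀, map_sub, map_add, map_mul, conj_conj] at h
  rw [div_mul_div_comm, one_add_div (mul_ne_zero h1 h2'), div_eq_zero_iff] at h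
  have h3 := h.resolve_right (mul_ne_zero h1 h2')
  refine (mul_eq_zero.1 ?_).resolve_left (one_add_mul_conj_ne_zero a)
  linear_combination h3

theorem rotateToZero_injective {a : ℂ} {p q : OnePoint ℂ}
    (hp : ¬IsAntipodal a p) (hq : ¬IsAntipodal a q) (h : rotateToZero a p = rotateToZero a q) :
    p = q := by
  have h1 := homDen_add_ne_zero hp
  have h2 := homDen_add_ne_zero hq
  rw [rotateToZero, rotateToZero, div_eq_div_iff h1 h2] at h
  have h3 : homNum p * homDen q - homNum q * homDen p = 0 := by
    refine (mul_eq_zero.1 ?_).resolve_left (one_add_mul_conj_ne_zero a)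
    linear_combination h
  induction p using OnePoint.rec with
  | infty =>
    induction q using OnePoint.rec with
    | infty => rfl
    | coe w => simp [homNum, homDen] at h3
  | coe z =>
    induction q using OnePoint.rec with
    | infty => simp [homNum, homDen] at h3
    | coe w =>
      have : z - w = 0 := by simpa [homNum, homDen] using h3
      rw [sub_eq_zero.1 this]

section

variable {F : ℂ → OnePoint ℂ} {a : ℂ}

theorem differentiableAt_rotateToZero (hF : IsMeromorphicMapOn F (ball 0 1)) {z : ℂ}
    (hz : z ∈ ball (0 : ℂ) 1) (ha : ¬IsAntipodal a (F z)) :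
    DifferentiableAt ℂ (fun w => rotateToZero a (F w)) z ∧
      sph (fun w => rotateToZero a (F w)) z = sphericalDeriv F z := by
  have hne := homDen_add_ne_zero ha
  by_cases h : F z = ∞
  · have h0 : F z ≠ ((0 : ℂ) : OnePoint ℂ) := by
      rw [h]
      exact OnePoint.infty_ne_coe 0
    have hev : ∀ᶠ w in 𝓝 z, rotateToZero a (F w)
        = (-a * chartInv (F w) + 1) / (1 * chartInv (F w) + conj a) := by
      filter_upwards [eventually_ne_of_ne hF hz h0] with w hw
      exact rotateToZero_of_ne_zero hw.2
    have hd := (hF.2 z hz).2 h0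
    have hne' : 1 * chartInv (F z) + conj a ≠ 0 := by
      rw [h] at hne ⊢
      simpa [homNum, homDen, chartInv_infty] using hne
    refine ⟨?_, ?_⟩
    · exact (((hd.const_mul _).add_const _).div ((hd.const_mul _).add_const _)
        hne').congr_of_eventuallyEq hev
    · rw [sphericalDeriv_eq_sph_chartInv h]
      exact (isConformalMatrix_rotateToZero_inv a).sph_eq hd hne' hev
  · have hev : ∀ᶠ w in 𝓝 z, rotateToZero a (F w)
        = (1 * chart (F w) + -a) / (conj a * chart (F w) + 1) := by
      filter_upwards [eventually_ne_of_ne hF hz h] with w hw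
      exact rotateToZero_of_ne_infty hw.2
    have hd := (hF.2 z hz).1 h
    have hne' : conj a * chart (F z) + 1 ≠ 0 := by
      obtain ⟨v, hv⟩ := OnePoint.ne_infty_iff_exists.1 h
      rw [← hv] at hne ⊢
      simpa [homNum, homDen, chart_coe, add_comm] using hne
    refine ⟨?_, ?_⟩
    · exact (((hd.const_mul _).add_const _).div ((hd.const_mul _).add_const _)
        hne').congr_of_eventuallyEq hev
    · rw [sphericalDeriv_eq_sph_chart h]
      exact (isConformalMatrix_rotateToZero a).sph_eq hd hne' hev

/-- A spherically convex map is, up to a rotation, an injective holomorphic function without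
antipodal values. -/
theorem exists_holomorphic_model (hF : IsSphericallyConvexMap F) :
    ∃ (a : ℂ) (f : ℂ → ℂ), (∀ z ∈ ball (0 : ℂ) 1, ¬IsAntipodal a (F z)) ∧
      (∀ z, f z = rotateToZero a (F z)) ∧
      DifferentiableOn ℂ f (ball 0 1) ∧ InjOn f (ball 0 1) ∧
      (∀ z ∈ ball (0 : ℂ) 1, ∀ w ∈ ball (0 : ℂ) 1, 1 + f z * conj (f w) ≠ 0) ∧
      ∀ z ∈ ball (0 : ℂ) 1, sph f z = sphericalDeriv F z := by
  -- By injectivity 0 and 1/2 are not both poles. Taking a = F(z₀) in the image ensures that F omits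
  -- the antipode of a, which is the pole of the rotation.
  obtain ⟨z₀, hz₀, hfin⟩ : ∃ z ∈ ball (0 : ℂ) 1, F z ≠ ∞ := by
    by_contra! h
    have h0 : (0 : ℂ) ∈ ball (0 : ℂ) 1 := mem_ball_self one_pos
    have h1 : (1 / 2 : ℂ) ∈ ball (0 : ℂ) 1 := by
      rw [mem_ball_zero_iff]
      norm_num
    have := hF.2.1 h0 h1 ((h _ h0).trans (h _ h1).symm)
    norm_num at this
  obtain ⟨a, ha⟩ := OnePoint.ne_infty_iff_exists.1 hfin
  have hanti : ∀ z ∈ ball (0 : ℂ) 1, ¬IsAntipodal a (F z) := fun z hz => by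
    rw [ha]
    exact not_isAntipodal hF hz₀ hz
  refine ⟨a, fun z => rotateToZero a (F z), hanti, fun _ => rfl, ?_, ?_, ?_, ?_⟩
  · exact fun z hz =>
      (differentiableAt_rotateToZero hF.1 hz (hanti z hz)).1.differentiableWithinAt
  · exact fun z hz w hw h => hF.2.1 hz hw (rotateToZero_injective (hanti z hz) (hanti w hw) h)
  · exact fun z hz w hw => one_add_rotateToZero_mul_conj_ne_zero (hanti z hz) (hanti w hw)
      (not_isAntipodal hF hz hw)
  · exact fun z hz => (differentiableAt_rotateToZero hF.1 hz (hanti z hz)).2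

/-! ### From the model back to the sphere, and areas of isometries. -/

theorem IsConformalMatrix.rotate {α β γ δ : ℂ} (h : IsConformalMatrix α β γ δ 1) (a : ℂ) :
    IsConformalMatrix (α + a * γ) (β + a * δ) (γ - conj a * α) (δ - conj a * β) (1 + ‖a‖ ^ 2) := by
  have hl := h.left
  have hr := h.right
  rw [ofReal_one] at hl hr
  refine ⟨by positivity, ?_, ?_, ?_⟩ <;>
    simp only [← one_add_mul_conj, map_add, map_sub, map_mul, conj_conj]
  · linear_combination (1 + a * conj a) * hl
  · linear_combination (1 + a * conj a) * hr
  · linear_combination (1 + a * conj a) * h.orth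

/-- In homogeneous coordinates the relation says that (αz + β, γz + δ) is proportional to the
rotated coordinates of F(z). The inverse rotation, up to the factor 1 + |a|², recovers F(z) as a
quotient of affine functions with a conformal matrix. -/
theorem isSphericalIsometry_of_moebius
    (hanti : ∀ z ∈ ball (0 : ℂ) 1, ¬IsAntipodal a (F z)) {α β γ δ : ℂ}
    (hM : IsConformalMatrix α β γ δ 1)
    (h : ∀ z ∈ ball (0 : ℂ) 1, rotateToZero a (F z) * (γ * z + δ) = α * z + β) :
    IsSphericalIsometry F := by
  obtain ⟨T, hT, hTz⟩ := (hM.rotate a).exists_sphereRotation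
  refine ⟨T, hT, fun z hz => ?_⟩
  have hY := homDen_add_ne_zero (hanti z hz)
  have hz' := h z hz
  rw [rotateToZero, div_mul_eq_mul_div, div_eq_iff hY] at hz'
  -- Otherwise αz + β vanishes too, contradicting |αz + β|² + |γz + δ|² = 1 + |z|².
  have hne : γ * z + δ ≠ 0 := by
    intro h0
    have h1 := hM.norm_sq_add z
    rw [h0, mul_zero] at hz'
    rw [h0, (mul_eq_zero.1 hz'.symm).resolve_right hY] at h1
    simp only [zero_mul, add_zero, ofReal_one, one_mul] at h1
    exact one_add_mul_conj_ne_zero z h1.symm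
  set k := (γ * z + δ) / (homDen (F z) + conj a * homNum (F z)) with hk
  have hk0 : k ≠ 0 := div_ne_zero hne hY
  have e1 : γ * z + δ = k * (homDen (F z) + conj a * homNum (F z)) := by
    rw [hk, div_mul_cancel₀ _ hY]
  have e2 : α * z + β = k * (homNum (F z) - a * homDen (F z)) := by
    apply mul_right_cancel₀ hY
    rw [← hz', e1]
    ring
  rw [hTz, show (α + a * γ) * z + (β + a * δ) = k * (1 + a * conj a) * homNum (F z) by
    linear_combination e2 + a * e1,
    show (γ - conj a * α) * z + (δ - conj a * β) = k * (1 + a * conj a) * homDen (F z) by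
    linear_combination e1 - conj a * e2,
    sphereDiv_mul_left (mul_ne_zero hk0 (one_add_mul_conj_ne_zero a)), sphereDiv_homNum_homDen]

theorem sphereDiv_eq_infty_iff {p q : ℂ} : sphereDiv p q = ∞ ↔ q = 0 := by
  unfold sphereDiv
  by_cases hq : q = 0 <;> simp [hq]

theorem chart_sphereDiv {p q : ℂ} (hq : q ≠ 0) : chart (sphereDiv p q) = p / q := by
  rw [sphereDiv, if_neg hq]
  rfl

theorem chartInv_sphereDiv (p q : ℂ) : chartInv (sphereDiv p q) = q / p := by
  unfold sphereDiv
  by_cases hq : q = 0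
  · simp [hq, chartInv_infty]
  · simp [hq, chartInv_coe]

theorem exists_isConformalMatrix_of_mem_sphereRotations {T : OnePoint ℂ → OnePoint ℂ}
    (hT : T ∈ sphereRotations) : ∃ (α β γ δ : ℂ) (K : ℝ), IsConformalMatrix α β γ δ K ∧
      ∀ z : ℂ, T z = sphereDiv (α * z + β) (γ * z + δ) := by
  have he : ∀ θ : ℝ, exp (θ * I) * conj (exp (θ * I)) = 1 := fun θ => by
    rw [mul_conj, normSq_eq_norm_sq, norm_exp_ofReal_mul_I]
    norm_num
  rcases hT with ⟨θ, a, rfl⟩ | ⟨θ, rfl⟩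
  · have h := he θ
    refine ⟨exp (θ * I), -(exp (θ * I) * a), conj a, 1, 1 + ‖a‖ ^ 2, ⟨by positivity, ?_, ?_, ?_⟩,
      fun z => ?_⟩
    · rw [← one_add_mul_conj, h, conj_conj, mul_comm a]
    · rw [← one_add_mul_conj, map_neg, map_mul, map_one]
      linear_combination a * conj a * h
    · rw [map_neg, map_mul, map_one]
      linear_combination (-conj a) * h
    · change sphereDiv (exp (θ * I) * (z - a)) (1 + z * conj a) = _
      congr 1 <;> ring
  · refine ⟨0, exp (θ * I), 1, 0, 1, ⟨one_pos, by simp, by simp [he θ], by simp⟩, fun z => ?_⟩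
    change sphereDiv (exp (θ * I)) z = _
    congr 1 <;> ring

/-- The identity has spherical derivative 1/(1+|z|²), and conformal matrices preserve it; at a pole
1/F is described by the matrix with its rows swapped. -/
theorem IsSphericalIsometry.sphericalDeriv_eq (hF : IsSphericalIsometry F) {z : ℂ}
    (hz : z ∈ ball (0 : ℂ) 1) : sphericalDeriv F z = 1 / (1 + ‖z‖ ^ 2) := by
  obtain ⟨T, hT, hFT⟩ := hF
  obtain ⟨α, β, γ, δ, K, hM, hTz⟩ := exists_isConformalMatrix_of_mem_sphereRotations hT
  have hFz : ∀ w ∈ ball (0 : ℂ) 1, F w = sphereDiv (α * w + β) (γ * w + δ) := fun w hw => by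
    rw [hFT w hw, hTz]
  have hid : sph (fun w => w) z = 1 / (1 + ‖z‖ ^ 2) := by
    rw [sph, deriv_id'', norm_one]
  have hc : ∀ x y : ℂ, ContinuousAt (fun w : ℂ => x * w + y) z := fun x y => by fun_prop
  rw [← hid]
  by_cases h : F z = ∞
  · rw [sphericalDeriv_eq_sph_chartInv h]
    have hq : γ * z + δ = 0 := sphereDiv_eq_infty_iff.1 ((hFz z hz).symm.trans h)
    have hp : α * z + β ≠ 0 := by
      intro h0
      have h1 := hM.norm_sq_add z
      rw [h0, hq, zero_mul, zero_add] at h1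
      exact mul_ne_zero (by exact_mod_cast hM.pos.ne') (one_add_mul_conj_ne_zero z) h1.symm
    refine hM.swap.sph_eq differentiableAt_id hp ?_
    filter_upwards [isOpen_ball.mem_nhds hz] with w hw
    rw [hFz w hw, chartInv_sphereDiv]
  · rw [sphericalDeriv_eq_sph_chart h]
    have hq : γ * z + δ ≠ 0 := fun h0 => h ((hFz z hz).trans (sphereDiv_eq_infty_iff.2 h0))
    refine hM.sph_eq differentiableAt_id hq ?_
    filter_upwards [isOpen_ball.mem_nhds hz, (hc γ δ).eventually_ne hq] with w hw hw'
    rw [hFz w hw, chart_sphereDiv hw']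

theorem IsSphericalIsometry.imageArea_eq (hF : IsSphericalIsometry F) {r : ℝ} (hr1 : r ≤ 1) :
    imageArea F r = diskArea r := by
  refine setLIntegral_congr_fun measurableSet_ball fun z hz => ?_
  rw [hF.sphericalDeriv_eq (ball_subset_ball hr1 hz), div_pow, one_pow]

end

end SphericalGeometry

/-! ### The theorem. -/

theorem theorem1p1 (f : ℂ → OnePoint ℂ) (hf : SphericalGeometry.IsSphericallyConvexMap f) :
    (∀ r : ℝ, 0 < r → r < 1 →
      SphericalGeometry.imageArea f r ≤ SphericalGeometry.diskArea r ∧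
      SphericalGeometry.diskArea r = ENNReal.ofReal (Real.pi * r ^ 2 / (1 + r ^ 2))) ∧
    ((∃ r : ℝ, 0 < r ∧ r < 1 ∧
        SphericalGeometry.imageArea f r = SphericalGeometry.diskArea r) ↔
      SphericalGeometry.IsSphericalIsometry f) ∧
    (SphericalGeometry.IsSphericalIsometry f → ∀ r : ℝ, 0 < r → r < 1 →
      SphericalGeometry.imageArea f r = SphericalGeometry.diskArea r) := by
  open SphericalGeometry Metric in
  obtain ⟨a, g, hanti, hgF, hg, hinj, hg', hsph⟩ := exists_holomorphic_model hf
  have harea : ∀ r : ℝ, 0 < r → r < 1 → imageArea f r = ENNReal.ofReal (discArea g r) := by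
    intro r hr hr1
    rw [← lintegral_sph_sq_eq_discArea hg hr.le hr1]
    refine MeasureTheory.setLIntegral_congr_fun measurableSet_ball fun z hz => ?_
    rw [hsph z (ball_subset_ball hr1.le hz)]
  refine ⟨fun r hr hr1 => ⟨?_, diskArea_eq hr.le⟩, ⟨?_, fun h => ?_⟩,
    fun h r _ hr1 => h.imageArea_eq hr1.le⟩
  · rw [harea r hr hr1, diskArea_eq hr.le]
    exact ENNReal.ofReal_le_ofReal (discArea_le hg hinj hg' hr hr1)
  · rintro ⟨r, hr, hr1, heq⟩
    rw [harea r hr hr1, diskArea_eq hr.le,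
      ENNReal.ofReal_eq_ofReal_iff (discArea_nonneg hr.le) (by positivity)] at heq
    obtain ⟨α, β, γ, δ, hM, h⟩ := exists_eq_moebius_of_sph_eq hg hr hr1 fun z h1 h2 =>
      sph_eq_of_discArea_eq hg hinj hg' hr heq h1 h2
    refine isSphericalIsometry_of_moebius hanti hM fun z hz => ?_
    rw [← hgF]
    exact h z hz
  · exact ⟨1 / 2, by norm_num, by norm_num, h.imageArea_eq (by norm_num)⟩
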